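/- Let $\rho>1$ and let $\mathcal W_\rho$ be the Banach space of Fourier series $f(\lambda)=\sum_{k\in\mathbb Z}f_k\lambda^k$ with $\|f\|_\rho=\sum_k|f_k|\rho^{|k|}<\infty$; write $f^0=f_0$ for the constant coefficient. Let $\Lambda\mathfrak{sl}(2,\mathbb C)_\rho$ and $\Lambda SL(2,\mathbb C)_\rho$ be the sets of $2\times2$ matrices with entries in $\mathcal W_\rho$ which, for every $\lambda\in\mathbb S^1$, have trace $0$, respectively determinant $1$. Let $D(0,r)=\{|z|<r\}\subset\mathbb C$ and $D^*(0,r)=D(0,r)\setminus\{0\}$, $r>0$. A DPW potential on $D^*(0,r)$ is a 1-form $\eta=A(z,\lambda)\,dz$ with $z\mapsto A(z,\cdot)\in\Lambda\mathfrak{sl}(2,\mathbb C)_\rho$ holomorphic, such that $\lambda A$ has no negative powers of $\lambda$ and the coefficient of $\lambda^{-1}$ in $A$ is nilpotent (possibly zero) at every point. Let $\lambda_1,\lambda_2\in\mathbb C^*$ (Sym points) and $\theta\in\mathbb R$ satisfy $|\lambda_1|,|\lambda_2|<\rho$, $\lambda_1+\lambda_2\in e^{i\theta}\mathbb R$ and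 $\lambda_1\lambda_2=e^{2i\theta}$. If $\Phi$ is a solution of $d\Phi=\Phi\eta$ on the universal cover of $D^*(0,r)$ with values in $\Lambda SL(2,\mathbb C)_\rho$ and $M(\lambda)$ is its monodromy along a generator of $\pi_1(D^*(0,r))$, we say that $\Phi$ solves the Monodromy Problem if $M(\lambda)\in SU(2)$ for all $\lambda\in\mathbb S^1$, $M(\lambda_1)=\mathrm{Id}$, and in addition $M(\lambda_2)=\mathrm{Id}$ if $\lambda_2\ne\lambda_1$, or $M'(\lambda_1)=0$ if $\lambda_2=\lambda_1$. **Theorem.** Fix an integer $m\ge1$ and $\varepsilon>0$. For $t\in(-\varepsilon,\varepsilon)$ let $\eta_t$ be a family of DPW potentials on $D^*(0,r)$ and $\Phi_t$ a family of solutions of $d\Phi_t=\Phi_t\eta_t$ on its universal cover, with $C^1$-dependence on $(t,z)$ as maps into $\Lambda\mathfrak{sl}(2,\mathbb C)_\rho$ and $\Lambda SL(2,\mathbb C)_\rho$ respectively. Assume: 1. there are $a_t,b_t,c_t\in\mathcal W_\rho$ such that $$\eta_t(z,\lambda)=\begin{pmatrix}0&\lambda^{-1}\\0&0\end{pmatrix}\left(\frac{a_t(\lambda)}{z^{2m+1}}+\frac{b_t(\lambda)}{z^{m+1}}+\frac{c_t(\lambda)}{z}\right)dz+\Xi_t(z,\lambda)\,dz,$$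 where $\Xi_t$ is a matrix with entries in $\mathcal W_\rho$, holomorphic with respect to $z$ in $D(0,r)$; 2. $\eta_0=\begin{pmatrix}0&0\\ m z^{m-1}dz&0\end{pmatrix}$; 3. $\Phi_t$ solves the Monodromy Problem for all $t\in(-\varepsilon,\varepsilon)$; 4. $a_t^0=\mathrm{Re}(e^{-i\theta}b_t^0)=0$ for all $t\in(-\varepsilon,\varepsilon)$. Then there is $\delta>0$ such that $a_t=b_t=c_t=0$ for all $|t|<\delta$. In particular, for these $t$ the potential $\eta_t$ extends holomorphically to $z=0$. -/

import Mathlib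

noncomputable section

/-- Families of Fourier coefficients `(f_k)_{k ∈ ℤ}` with `∑ |f_k| ρ^|k| < ∞`. -/
def wienerSubmodule (ρ : ℝ) : Submodule ℂ (ℤ → ℂ) where
  carrier := {f | Summable fun k : ℤ => ‖f k‖ * |ρ| ^ k.natAbs}
  zero_mem' := by
    change Summable fun k : ℤ => ‖(0 : ℂ)‖ * |ρ| ^ k.natAbs
    simp
  add_mem' := by
    intro f g hf hg
    refine Summable.of_nonneg_of_le (fun k => by positivity) (fun k => ?_) (hf.add hg)
    rw [← add_mul]
    exact mul_le_mul_of_nonneg_right (norm_add_le _ _) (by positivity)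
  smul_mem' := by
    intro c f hf
    refine (hf.mul_left ‖c‖).congr (fun k => ?_)
    simp [mul_assoc]

/-- The space `𝒲_ρ` of loops `f = ∑ f_k λ^k` with `‖f‖_ρ = ∑ |f_k| ρ^|k| < ∞`
(only used for `ρ > 1`, where `|ρ| = ρ`). -/
def Wiener (ρ : ℝ) : Type := wienerSubmodule ρ

namespace Wiener

variable {ρ : ℝ}

instance : AddCommGroup (Wiener ρ) := inferInstanceAs (AddCommGroup (wienerSubmodule ρ))

instance : Module ℂ (Wiener ρ) := inferInstanceAs (Module ℂ (wienerSubmodule ρ))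

/-- The Fourier coefficient `f_k`. -/
def coeff (f : Wiener ρ) (k : ℤ) : ℂ := f.1 k

theorem coeff_add (f g : Wiener ρ) (k : ℤ) : (f + g).coeff k = f.coeff k + g.coeff k := rfl

theorem coeff_smul (c : ℂ) (f : Wiener ρ) (k : ℤ) : (c • f).coeff k = c * f.coeff k := rfl

theorem coeff_zero (k : ℤ) : (0 : Wiener ρ).coeff k = 0 := rfl

theorem summable_norm (f : Wiener ρ) :
    Summable fun k : ℤ => ‖f.coeff k‖ * |ρ| ^ k.natAbs := f.2

theorem ext_coeff {f g : Wiener ρ} (h : ∀ k, f.coeff k = g.coeff k) : f = g :=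
  Subtype.ext (funext h)

/-- The norm `‖f‖_ρ = ∑ |f_k| ρ^|k|`. -/
instance : Norm (Wiener ρ) := ⟨fun f => ∑' k : ℤ, ‖f.coeff k‖ * |ρ| ^ k.natAbs⟩

theorem norm_def (f : Wiener ρ) : ‖f‖ = ∑' k : ℤ, ‖f.coeff k‖ * |ρ| ^ k.natAbs := rfl

theorem normCore (hρ : 1 < ρ) : NormedSpace.Core ℂ (Wiener ρ) where
  norm_nonneg f := tsum_nonneg fun k => by positivity
  norm_smul c f := by
    simp only [norm_def, coeff_smul, norm_mul, mul_assoc, tsum_mul_left]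
  norm_triangle f g := by
    simp only [norm_def]
    rw [← (summable_norm f).tsum_add (summable_norm g)]
    refine (summable_norm (f + g)).tsum_le_tsum (fun k => ?_)
      ((summable_norm f).add (summable_norm g))
    rw [← add_mul, coeff_add]
    exact mul_le_mul_of_nonneg_right (norm_add_le _ _) (by positivity)
  norm_eq_zero_iff f := by
    have hpos : 0 < |ρ| := abs_pos.mpr (by linarith)
    constructor
    · intro h
      have h0 := (hasSum_zero_iff_of_nonneg (fun k : ℤ => by positivity)).mp
        (h ▸ (summable_norm f).hasSum :
          HasSum (fun k : ℤ => ‖f.coeff k‖ * |ρ| ^ k.natAbs) 0)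
      refine ext_coeff fun k => ?_
      have hk := congrFun h0 k
      rw [coeff_zero]
      rcases mul_eq_zero.mp hk with h1 | h1
      · exact norm_eq_zero.mp h1
      · exact absurd h1 (pow_pos hpos _).ne'
    · rintro rfl
      simp [norm_def, coeff_zero]

instance [h : Fact (1 < ρ)] : NormedAddCommGroup (Wiener ρ) :=
  NormedAddCommGroup.ofCore (normCore h.out)

instance [h : Fact (1 < ρ)] : NormedSpace ℂ (Wiener ρ) :=
  NormedSpace.ofCore (normCore h.out)

/-- The value `f(λ) = ∑ f_k λ^k`, an absolutely convergent series for `1/ρ ≤ |λ| ≤ ρ`. -/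
def eval (f : Wiener ρ) (lam : ℂ) : ℂ := ∑' k : ℤ, f.coeff k * lam ^ k

end Wiener

/-- `2 × 2` matrices of loops in `𝒲_ρ`. -/
abbrev LoopMatrix (ρ : ℝ) : Type := Matrix (Fin 2) (Fin 2) (Wiener ρ)

/-- The value of a matrix of loops at `λ`. -/
def LoopMatrix.eval {ρ : ℝ} (A : LoopMatrix ρ) (lam : ℂ) : Matrix (Fin 2) (Fin 2) ℂ :=
  Matrix.of fun i j => (A i j).eval lam

/-- The coefficient of `λ^k` of a matrix of loops. -/
def LoopMatrix.coeff {ρ : ℝ} (A : LoopMatrix ρ) (k : ℤ) : Matrix (Fin 2) (Fin 2) ℂ :=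
  Matrix.of fun i j => (A i j).coeff k

/-- The loop group `ΛSL(2,ℂ)_ρ`. -/
def LoopSL (ρ : ℝ) : Set (LoopMatrix ρ) :=
  {A | ∀ lam ∈ Metric.sphere (0 : ℂ) 1, (A.eval lam).det = 1}

/-- The loop algebra `Λsl(2,ℂ)_ρ`. -/
def LoopTraceFree (ρ : ℝ) : Set (LoopMatrix ρ) :=
  {A | ∀ lam ∈ Metric.sphere (0 : ℂ) 1, (A.eval lam).trace = 0}

/-- A map into matrices of loops that is holomorphic on `U`
(as a map into the normed space `𝒲_ρ`, entry by entry). -/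
def LoopHolomorphicOn {ρ : ℝ} [Fact (1 < ρ)] (A : ℂ → LoopMatrix ρ) (U : Set ℂ) : Prop :=
  ∀ i j, DifferentiableOn ℂ (fun z => A z i j) U

/-- A family of matrices of loops with `C¹`-dependence on `(t, z) ∈ I × U`
(as a map into the normed space `𝒲_ρ`, entry by entry; `ℂ` is regarded as a real plane). -/
def LoopC1On {ρ : ℝ} [Fact (1 < ρ)] (A : ℝ → ℂ → LoopMatrix ρ) (I : Set ℝ) (U : Set ℂ) : Prop :=
  ∀ i j, ContDiffOn ℝ 1 (fun p : ℝ × ℂ => A p.1 p.2 i j) (I ×ˢ U)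

/-- The 1-form `A(z) dz` is a DPW potential on the open set `U ⊆ ℂ`: it is holomorphic with
values in `Λsl(2,ℂ)_ρ`, the loop `λ A(z)` has no negative Fourier coefficients, and the residue
of `A(z)` at `λ = 0` is nilpotent. The residue is allowed to vanish, as it does for the
potential `m z^{m-1} dz` in the lower left corner. -/
structure IsDPWPotential {ρ : ℝ} [Fact (1 < ρ)] (A : ℂ → LoopMatrix ρ) (U : Set ℂ) : Prop where
  holomorphic : LoopHolomorphicOn A U
  traceFree : ∀ z ∈ U, A z ∈ LoopTraceFree ρ
  coeff_eq_zero : ∀ z ∈ U, ∀ k : ℤ, k < -1 → (A z).coeff k = 0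
  nilpotent : ∀ z ∈ U, IsNilpotent ((A z).coeff (-1))

/-- The punctured disc `D^*(0,r)`. -/
def puncturedDisc (r : ℝ) : Set ℂ := Metric.ball 0 r \ {0}

/-- The universal cover of `D^*(0,r)`, realised as the half plane `{w | Re w < log r}` with
covering map `w ↦ exp w`; the deck transformations are generated by `w ↦ w + 2πi`. -/
def coverOfPuncturedDisc (r : ℝ) : Set ℂ := {w | Complex.exp w ∈ puncturedDisc r}

/-- `Φ` solves `dΦ = Φ η` on the universal cover of `D^*(0,r)`, where `η = A(z) dz`. The pull
back of `A(z) dz` under `z = exp w` is `A(exp w) exp w dw`. -/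
def SolvesPotential {ρ : ℝ} (A Φ : ℂ → LoopMatrix ρ) (r : ℝ) : Prop :=
  ∀ w ∈ coverOfPuncturedDisc r, ∀ lam ∈ Metric.sphere (0 : ℂ) 1, ∀ i j,
    HasDerivAt (fun u => (Φ u).eval lam i j)
      (((Φ w).eval lam * (Complex.exp w • (A (Complex.exp w)).eval lam)) i j) w

/-- The monodromy `M(λ)` of `Φ` along the generator of the fundamental group of the punctured
disc, with base point `w₀` in the universal cover: `Φ(w₀ + 2πi, λ) = M(λ) Φ(w₀, λ)`. -/
def monodromy {ρ : ℝ} (Φ : ℂ → LoopMatrix ρ) (w₀ lam : ℂ) : Matrix (Fin 2) (Fin 2) ℂ :=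
  (Φ (w₀ + 2 * Real.pi * Complex.I)).eval lam * ((Φ w₀).eval lam)⁻¹

/-- The Monodromy Problem with Sym points `l₁`, `l₂` for a monodromy `M`. -/
def MonodromyProblem (M : ℂ → Matrix (Fin 2) (Fin 2) ℂ) (l₁ l₂ : ℂ) : Prop :=
  (∀ lam ∈ Metric.sphere (0 : ℂ) 1, M lam ∈ Matrix.specialUnitaryGroup (Fin 2) ℂ) ∧
  M l₁ = 1 ∧
  (l₂ ≠ l₁ → M l₂ = 1) ∧
  (l₂ = l₁ → ∀ i j, HasDerivAt (fun lam => M lam i j) 0 l₁)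

end

/-!
Let `F` be the lower left elementary matrix. At `t = 0` the solution is `Φ₀ = C (1 + zᵐ F)` with
`C` independent of `z`, so after the gauge `1 - zᵐ F`, and a second holomorphic gauge that removes
the regular part of the potential, the frame stays close to `C` along a loop around `0` while its
derivative is the frame times the conjugated polar part. Integrating around the loop, the
monodromy satisfies `M - 1 ≈ C (λ⁻¹ X) C⁻¹`, with an error that is small relative to `a`, `b`, `c`
and uniform in `λ`, also for `|λ| ≠ 1`; here `X` is the residue after the first gauge, `λ⁻¹` being
taken out. It is holomorphic in the disc `|λ| < ρ`, because `λ A` has no negative powers of `λ`,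
and `det X` is `-4π² (a c - b²)`.

The trace-free part `N` of `M` is skew-Hermitian on the unit circle and vanishes at the Sym
points. Hence `N = p K` with `p = e^{-iθ} λ⁻¹ (λ - λ₁) (λ - λ₂)`, which is real on the unit
circle, so that `K` is skew-Hermitian there too, and `‖K‖² = det K`. On a circle inside the Sym
points `det K` is close to `e^{2iθ} ((λ - λ₁) (λ - λ₂))⁻² det X`, whose mean is its value
`e^{-2iθ} det X(0)` at `0`. The normalisation at `λ = 0` gives this number a nonpositive real
part, so the mean of `‖K‖²` over the unit circle is at most the error. Thus `X` is small, relative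
to its own maximum, inside the unit disc, and by the symmetry `λ ↦ 1 / conj λ` of `N` also on a
circle `|λ| = s > 1`. By the maximum principle `X = 0`.
-/

section

open Complex Metric Set Filter Topology
open scoped Matrix.Norms.L2Operator ComplexConjugate

/-! ### Fourier series on an annulus -/

/-- The open annulus `ρ⁻¹ < |z| < ρ`, on which loops in `𝒲_ρ` are holomorphic. -/
def openAnnulus (ρ : ℝ) : Set ℂ := {z | ρ⁻¹ < ‖z‖ ∧ ‖z‖ < ρ}

section Annulus

variable {ρ : ℝ} {z : ℂ}

theorem isOpen_openAnnulus (ρ : ℝ) : IsOpen (openAnnulus ρ) :=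
  (isOpen_lt continuous_const continuous_norm).inter (isOpen_lt continuous_norm continuous_const)

theorem sphere_subset_openAnnulus (hρ : 1 < ρ) : sphere (0 : ℂ) 1 ⊆ openAnnulus ρ := by
  intro z hz
  rw [mem_sphere_zero_iff_norm] at hz
  exact ⟨by rw [hz]; exact inv_lt_one_of_one_lt₀ hρ, by rwa [hz]⟩

theorem ne_zero_of_mem_openAnnulus (hρ : 1 < ρ) (hz : z ∈ openAnnulus ρ) : z ≠ 0 :=
  norm_pos_iff.mp ((inv_pos.mpr (zero_lt_one.trans hρ)).trans hz.1)

theorem mem_openAnnulus_of_le {s : ℝ} (hs : 1 < s) (hsρ : s < ρ) (h₁ : s⁻¹ ≤ ‖z‖) (h₂ : ‖z‖ ≤ s) :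
    z ∈ openAnnulus ρ :=
  ⟨((inv_lt_inv₀ (by linarith) (by linarith)).mpr hsρ).trans_le h₁, h₂.trans_lt hsρ⟩

theorem inv_conj_mem_openAnnulus (hρ : 1 < ρ) (hz : z ∈ openAnnulus ρ) :
    (conj z)⁻¹ ∈ openAnnulus ρ := by
  have hz0 : 0 < ‖z‖ := norm_pos_iff.mpr (ne_zero_of_mem_openAnnulus hρ hz)
  rw [openAnnulus, mem_ofPred_eq, norm_inv, RCLike.norm_conj]
  exact ⟨(inv_lt_inv₀ (by linarith) hz0).mpr hz.2, inv_lt_of_inv_lt₀ (by linarith) hz.1⟩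

theorem inv_conj_eq_self (hz : z ∈ sphere (0 : ℂ) 1) : (conj z)⁻¹ = z := by
  rw [mem_sphere_zero_iff_norm] at hz
  rw [Complex.inv_eq_conj (by rw [RCLike.norm_conj, hz]), Complex.conj_conj]

theorem openAnnulus_eq_image_exp (hρ : 1 < ρ) :
    openAnnulus ρ = Complex.exp '' (Complex.reLm ⁻¹' Ioo (-Real.log ρ) (Real.log ρ)) := by
  have hρ0 : 0 < ρ := by linarith
  have hmem (w : ℂ) : Complex.exp w ∈ openAnnulus ρ ↔ w.re ∈ Ioo (-Real.log ρ) (Real.log ρ) := by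
    rw [openAnnulus, mem_ofPred_eq, Complex.norm_exp, ← Real.log_inv, mem_Ioo,
      Real.lt_log_iff_exp_lt hρ0, Real.log_lt_iff_lt_exp (inv_pos.mpr hρ0)]
  ext z
  constructor
  · intro hz
    have hexp := Complex.exp_log (ne_zero_of_mem_openAnnulus hρ hz)
    exact ⟨Complex.log z, (hmem _).mp (by rwa [hexp]), hexp⟩
  · rintro ⟨w, hw, rfl⟩
    exact (hmem w).mpr hw

theorem isPreconnected_openAnnulus (hρ : 1 < ρ) : IsPreconnected (openAnnulus ρ) := by
  rw [openAnnulus_eq_image_exp hρ]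
  exact (((convex_Ioo _ _).linear_preimage Complex.reLm).isPreconnected).image _
    Complex.continuous_exp.continuousOn

theorem frequently_mem_sphere_nhdsNE_one : ∃ᶠ z in 𝓝[≠] (1 : ℂ), z ∈ sphere (0 : ℂ) 1 := by
  have htendsto : Tendsto (fun τ : ℝ => Complex.exp (τ * I)) (𝓝[>] 0) (𝓝[≠] 1) := by
    refine tendsto_nhdsWithin_iff.mpr ⟨?_, ?_⟩
    · have : ContinuousAt (fun τ : ℝ => Complex.exp (τ * I)) 0 := by fun_prop
      simpa using this.tendsto.mono_left nhdsWithin_le_nhds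
    · filter_upwards [Ioo_mem_nhdsGT one_pos] with τ hτ h
      have him := congrArg Complex.im h
      rw [Complex.exp_ofReal_mul_I_im, Complex.one_im] at him
      exact (Real.sin_pos_of_pos_of_lt_pi hτ.1 (by linarith [hτ.2, Real.pi_gt_three])).ne' him
  exact htendsto.frequently (Eventually.frequently (Eventually.of_forall fun τ => by
    rw [mem_sphere_zero_iff_norm, Complex.norm_exp_ofReal_mul_I]))

theorem eqOn_openAnnulus_of_eqOn_sphere {E : Type*} [NormedAddCommGroup E] [NormedSpace ℂ E]
    [CompleteSpace E] (hρ : 1 < ρ) {f g : ℂ → E} (hf : DifferentiableOn ℂ f (openAnnulus ρ))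
    (hg : DifferentiableOn ℂ g (openAnnulus ρ)) (h : EqOn f g (sphere 0 1)) :
    EqOn f g (openAnnulus ρ) :=
  (hf.analyticOnNhd (isOpen_openAnnulus ρ)).eqOn_of_preconnected_of_frequently_eq
    (hg.analyticOnNhd (isOpen_openAnnulus ρ)) (isPreconnected_openAnnulus hρ)
    (sphere_subset_openAnnulus hρ (by simp : (1 : ℂ) ∈ sphere (0 : ℂ) 1))
    (frequently_mem_sphere_nhdsNE_one.mono fun _ hz => h hz)

theorem norm_zpow_le_pow_natAbs (hρ : 1 < ρ) (hz : z ∈ openAnnulus ρ) (k : ℤ) :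
    ‖z ^ k‖ ≤ |ρ| ^ k.natAbs := by
  have hρ0 : 0 < ρ := by linarith
  rw [abs_of_pos hρ0, norm_zpow]
  rcases Int.natAbs_eq k with h | h
  · rw [h, zpow_natCast, Int.natAbs_natCast]
    exact pow_le_pow_left₀ (norm_nonneg z) hz.2.le _
  · rw [h, zpow_neg, zpow_natCast, Int.natAbs_neg, Int.natAbs_natCast, ← inv_pow]
    exact pow_le_pow_left₀ (by positivity) (inv_le_of_inv_le₀ hρ0 hz.1.le) _

end Annulus

theorem circleIntegral_zpow {R : ℝ} (hR : R ≠ 0) (k : ℤ) :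
    (∮ z in C(0, R), z ^ k) = if k = -1 then 2 * Real.pi * I else 0 := by
  split_ifs with h
  · subst h
    simpa using circleIntegral.integral_sub_center_inv (0 : ℂ) hR
  · simpa only [sub_zero] using circleIntegral.integral_sub_zpow_of_ne h 0 0 R

namespace Wiener

variable {ρ : ℝ}

theorem eval_zero_loop (z : ℂ) : (0 : Wiener ρ).eval z = 0 := by
  simp only [eval, coeff_zero, zero_mul, tsum_zero]

theorem eval_zero (f : Wiener ρ) : f.eval 0 = f.coeff 0 := by
  rw [eval, tsum_eq_single 0 fun k hk => by rw [zero_zpow k hk, mul_zero]]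
  simp

theorem differentiableOn_eval_ball (f : Wiener ρ) (hf : ∀ k < 0, f.coeff k = 0) :
    DifferentiableOn ℂ f.eval (ball 0 ρ) := by
  refine differentiableOn_tsum_of_summable_norm (summable_norm f) (fun k z _ => ?_)
    isOpen_ball (fun k z hz => ?_)
  · rcases lt_or_ge k 0 with hk | hk
    · simp only [hf k hk, zero_mul, differentiableWithinAt_const]
    · exact ((differentiableAt_zpow.mpr (Or.inr hk)).const_mul _).differentiableWithinAt
  · rcases lt_or_ge k 0 with hk | hk
    · simp only [hf k hk, zero_mul, norm_zero, le_refl]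
    · lift k to ℕ using hk
      rw [norm_mul, zpow_natCast, norm_pow, Int.natAbs_natCast]
      exact mul_le_mul_of_nonneg_left (pow_le_pow_left₀ (norm_nonneg _)
        ((mem_ball_zero_iff.mp hz).le.trans (le_abs_self ρ)) _) (norm_nonneg _)

variable [hρ : Fact (1 < ρ)]

theorem norm_coeff_le_mul_pow (f : Wiener ρ) (k : ℤ) :
    ‖f.coeff k‖ ≤ ‖f.coeff k‖ * |ρ| ^ k.natAbs :=
  le_mul_of_one_le_right (norm_nonneg _) (one_le_pow₀ (hρ.out.le.trans (le_abs_self ρ)))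

theorem norm_coeff_le (f : Wiener ρ) (k : ℤ) : ‖f.coeff k‖ ≤ ‖f‖ :=
  (f.norm_coeff_le_mul_pow k).trans ((summable_norm f).le_tsum k fun _ _ => by positivity)

theorem norm_coeff_mul_zpow_le (f : Wiener ρ) {z : ℂ} (hz : z ∈ openAnnulus ρ) (k : ℤ) :
    ‖f.coeff k * z ^ k‖ ≤ ‖f.coeff k‖ * |ρ| ^ k.natAbs := by
  rw [norm_mul]
  exact mul_le_mul_of_nonneg_left (norm_zpow_le_pow_natAbs hρ.out hz k) (norm_nonneg _)

theorem summable_coeff_mul_zpow (f : Wiener ρ) {z : ℂ} (hz : z ∈ openAnnulus ρ) :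
    Summable fun k : ℤ => f.coeff k * z ^ k :=
  (summable_norm f).of_norm_bounded (f.norm_coeff_mul_zpow_le hz)

theorem norm_eval_le (f : Wiener ρ) {z : ℂ} (hz : z ∈ openAnnulus ρ) : ‖f.eval z‖ ≤ ‖f‖ :=
  tsum_of_norm_bounded (summable_norm f).hasSum (f.norm_coeff_mul_zpow_le hz)

/-- Evaluation at a point of the annulus, as a continuous linear map. -/
noncomputable def evalCLM {z : ℂ} (hz : z ∈ openAnnulus ρ) : Wiener ρ →L[ℂ] ℂ :=
  LinearMap.mkContinuous
    { toFun := fun f => f.eval z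
      map_add' := fun f g => by
        simp only [eval, coeff_add, add_mul]
        exact (f.summable_coeff_mul_zpow hz).tsum_add (g.summable_coeff_mul_zpow hz)
      map_smul' := fun c f => by
        simp only [eval, coeff_smul, mul_assoc, tsum_mul_left, RingHom.id_apply, smul_eq_mul] }
    1 fun f => (f.norm_eval_le hz).trans_eq (one_mul _).symm

/-- A Fourier coefficient, as a continuous linear map. -/
noncomputable def coeffCLM (k : ℤ) : Wiener ρ →L[ℂ] ℂ :=
  LinearMap.mkContinuous
    { toFun := fun f => f.coeff k
      map_add' := fun _ _ => rfl
      map_smul' := fun _ _ => rfl }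
    1 fun f => (f.norm_coeff_le k).trans_eq (one_mul _).symm

theorem differentiableOn_eval (f : Wiener ρ) : DifferentiableOn ℂ f.eval (openAnnulus ρ) :=
  differentiableOn_tsum_of_summable_norm (summable_norm f)
    (fun _ _ hz => ((differentiableAt_zpow.mpr
      (Or.inl (ne_zero_of_mem_openAnnulus hρ.out hz))).const_mul _).differentiableWithinAt)
    (isOpen_openAnnulus ρ) fun k _ hz => f.norm_coeff_mul_zpow_le hz k

theorem circleIntegral_zpow_mul_eval (f : Wiener ρ) (k : ℤ) :
    (∮ z in C(0, 1), z ^ (-k - 1) * f.eval z) = 2 * Real.pi * I * f.coeff k := by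
  have hne (τ : ℝ) : circleMap 0 1 τ ≠ 0 := circleMap_ne_center one_ne_zero
  have hterm (j : ℤ) : (∮ z in C(0, 1), f.coeff j * z ^ (j - k - 1)) =
      if j = k then 2 * Real.pi * I * f.coeff k else 0 := by
    rw [circleIntegral.integral_const_mul (f.coeff j) (fun z => z ^ (j - k - 1)),
      circleIntegral_zpow one_ne_zero]
    by_cases hj : j = k
    · subst hj; simp [mul_comm]
    · rw [if_neg (by lia), if_neg hj, mul_zero]
  have hsum := intervalIntegral.hasSum_intervalIntegral_of_summable_norm (a := 0) (b := 2 * Real.pi)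
    (f := fun j : ℤ => (⟨fun τ => deriv (circleMap 0 1) τ •
        (f.coeff j * circleMap 0 1 τ ^ (j - k - 1)), by
      simp only [deriv_circleMap]
      exact ((continuous_circleMap 0 1).mul continuous_const).smul (continuous_const.mul
        ((continuous_circleMap 0 1).zpow₀ _ fun τ => Or.inl (hne τ)))⟩ : C(ℝ, ℂ))) ?_
  · have htsum := hsum.unique (HasSum.congr_fun (hasSum_ite_eq k (2 * Real.pi * I * f.coeff k)) ?_)
    · rw [← htsum, circleIntegral]
      refine intervalIntegral.integral_congr fun τ _ => ?_
      simp only [smul_eq_mul, ContinuousMap.coe_mk]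
      rw [tsum_mul_left, eval, ← tsum_mul_left]
      congr 2 with j
      rw [mul_left_comm, ← zpow_add₀ (hne τ)]
      congr 2
      ring
    · exact fun j => hterm j
  · refine (summable_norm f).of_nonneg_of_le (fun _ => norm_nonneg _) fun j => ?_
    rw [ContinuousMap.norm_le _ (by positivity)]
    rintro ⟨τ, hτ⟩
    simpa [norm_smul] using f.norm_coeff_le_mul_pow j

theorem coeff_eq_of_eval_eq_zpow_mul_eval {f g : Wiener ρ} {n : ℤ}
    (h : ∀ z ∈ sphere (0 : ℂ) 1, f.eval z = z ^ n * g.eval z) (k : ℤ) :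
    f.coeff (k + n) = g.coeff k := by
  refine mul_left_cancel₀ Complex.two_pi_I_ne_zero ?_
  rw [← circleIntegral_zpow_mul_eval, ← circleIntegral_zpow_mul_eval]
  refine circleIntegral.integral_congr zero_le_one fun z hz => ?_
  have hz0 : z ≠ 0 := ne_zero_of_mem_unit_sphere ⟨z, hz⟩
  rw [h z hz, ← mul_assoc, ← zpow_add₀ hz0]
  ring_nf

theorem ext_eval_sphere {f g : Wiener ρ} (h : EqOn f.eval g.eval (sphere 0 1)) : f = g :=
  ext_coeff fun k => by
    simpa using coeff_eq_of_eval_eq_zpow_mul_eval (n := 0) (fun z hz => by simpa using h hz) k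

end Wiener

/-! ### The operator norm of 2 × 2 matrices and circle averages -/

section L2OpNorm

variable {A B : Matrix (Fin 2) (Fin 2) ℂ}

theorem norm_apply_le_l2_opNorm (A : Matrix (Fin 2) (Fin 2) ℂ) (i j : Fin 2) : ‖A i j‖ ≤ ‖A‖ := by
  have hmul := A.l2_opNorm_mulVec (EuclideanSpace.single j 1)
  rw [PiLp.norm_single, norm_one, mul_one] at hmul
  simpa using (PiLp.norm_apply_le _ i).trans hmul

theorem l2_opNorm_single (i j : Fin 2) (c : ℂ) :
    ‖(Matrix.single i j c : Matrix (Fin 2) (Fin 2) ℂ)‖ = ‖c‖ := by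
  have h := CStarRing.norm_star_mul_self (x := (Matrix.single i j c : Matrix (Fin 2) (Fin 2) ℂ))
  rw [Matrix.star_eq_conjTranspose, Matrix.conjTranspose_single, Matrix.single_mul_single_same,
    ← Matrix.diagonal_single, Matrix.l2_opNorm_diagonal, Pi.norm_single, norm_mul, norm_star] at h
  exact (mul_self_inj_of_nonneg (norm_nonneg c) (norm_nonneg _)).mp h |>.symm

theorem l2_opNorm_le_sum (A : Matrix (Fin 2) (Fin 2) ℂ) : ‖A‖ ≤ ∑ i, ∑ j, ‖A i j‖ := by
  conv_lhs => rw [Matrix.matrix_eq_sum_single A]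
  refine (norm_sum_le _ _).trans (Finset.sum_le_sum fun i _ => ?_)
  refine (norm_sum_le _ _).trans_eq (Finset.sum_congr rfl fun j _ => l2_opNorm_single i j _)

theorem norm_sq_eq_re_det (hskew : A.conjTranspose = -A) (htrace : A.trace = 0) :
    ‖A‖ ^ 2 = A.det.re := by
  -- By Cayley-Hamilton the adjugate of a trace-free `A` is `-A`, which is here `Aᴴ`.
  have hadj : A.adjugate = star A := by
    rw [Matrix.star_eq_conjTranspose, hskew, Matrix.adjugate_fin_two]
    rw [Matrix.trace_fin_two] at htrace
    ext i j
    fin_cases i <;> fin_cases j <;> simp <;> linear_combination htrace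
  have hsq : A * star A = A.det • (1 : Matrix (Fin 2) (Fin 2) ℂ) := by rw [← hadj, A.mul_adjugate]
  have hdet : A.det = ((‖A 0 0‖ ^ 2 + ‖A 0 1‖ ^ 2 : ℝ) : ℂ) := by
    have h := congrFun (congrFun hsq 0) 0
    simp only [Matrix.mul_apply, Fin.sum_univ_two, Matrix.star_apply, Matrix.smul_apply,
      Matrix.one_apply_eq, smul_eq_mul, mul_one] at h
    rw [← h]
    push_cast
    rw [← Complex.mul_conj', ← Complex.mul_conj']
    rfl
  have hnorm : ‖A‖ ^ 2 = ‖A.det‖ := by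
    rw [sq, ← CStarRing.norm_self_mul_star, hsq, norm_smul, norm_one, mul_one]
  rw [hnorm, hdet, Complex.ofReal_re, Complex.norm_of_nonneg (by positivity)]

theorem norm_det_sub_det_le (A B : Matrix (Fin 2) (Fin 2) ℂ) :
    ‖A.det - B.det‖ ≤ 2 * ‖A - B‖ * (‖A‖ + ‖B‖) := by
  have hexpand : A.det - B.det = ((A - B) 0 0 * A 1 1 - (A - B) 0 1 * A 1 0) +
      (B 0 0 * (A - B) 1 1 - B 0 1 * (A - B) 1 0) := by
    simp only [Matrix.det_fin_two, Matrix.sub_apply]; ring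
  have hentry (P Q : Matrix (Fin 2) (Fin 2) ℂ) (i j k l : Fin 2) :
      ‖P i j * Q k l‖ ≤ ‖P‖ * ‖Q‖ := by
    rw [norm_mul]
    exact mul_le_mul (norm_apply_le_l2_opNorm P i j) (norm_apply_le_l2_opNorm Q k l)
      (norm_nonneg _) (norm_nonneg _)
  rw [hexpand]
  refine (norm_add_le_of_le (norm_sub_le_of_le (hentry _ _ _ _ _ _) (hentry _ _ _ _ _ _))
    (norm_sub_le_of_le (hentry _ _ _ _ _ _) (hentry _ _ _ _ _ _))).trans_eq ?_
  ring

theorem hasDerivAt_apply {f : ℂ → Matrix (Fin 2) (Fin 2) ℂ} {f' : Matrix (Fin 2) (Fin 2) ℂ} {x : ℂ}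
    (hf : HasDerivAt f f' x) (i j : Fin 2) : HasDerivAt (fun u => f u i j) (f' i j) x :=
  (Matrix.entryLinearMap ℂ ℂ i j).toContinuousLinearMap.hasFDerivAt.comp_hasDerivAt x hf

theorem hasDerivAt_matrix_iff {f : ℂ → Matrix (Fin 2) (Fin 2) ℂ} {f' : Matrix (Fin 2) (Fin 2) ℂ}
    {x : ℂ} : HasDerivAt f f' x ↔ ∀ i j, HasDerivAt (fun u => f u i j) (f' i j) x := by
  refine ⟨hasDerivAt_apply, fun h => ?_⟩
  have hsum (A : Matrix (Fin 2) (Fin 2) ℂ) :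
      A = ∑ i, ∑ j, A i j • (Matrix.single i j 1 : Matrix (Fin 2) (Fin 2) ℂ) := by
    simpa using Matrix.matrix_eq_sum_single A
  rw [hsum f', show f = fun u => ∑ i, ∑ j, f u i j • Matrix.single i j 1 from
    funext fun u => hsum _]
  exact HasDerivAt.fun_sum fun i _ => HasDerivAt.fun_sum fun j _ => (h i j).smul_const _

theorem differentiableAt_matrix_iff {f : ℂ → Matrix (Fin 2) (Fin 2) ℂ} {x : ℂ} :
    DifferentiableAt ℂ f x ↔ ∀ i j, DifferentiableAt ℂ (fun u => f u i j) x :=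
  ⟨fun h i j => (hasDerivAt_matrix_iff.mp h.hasDerivAt i j).differentiableAt, fun h =>
    (hasDerivAt_matrix_iff (f' := Matrix.of fun i j => deriv (fun u => f u i j) x).mpr
      fun i j => (h i j).hasDerivAt).differentiableAt⟩

theorem differentiable_det :
    Differentiable ℂ (Matrix.det : Matrix (Fin 2) (Fin 2) ℂ → ℂ) := by
  have hentry (i j : Fin 2) : Differentiable ℂ fun A : Matrix (Fin 2) (Fin 2) ℂ => A i j :=
    (Matrix.entryLinearMap ℂ ℂ i j).toContinuousLinearMap.differentiable
  have hdet : (Matrix.det : Matrix (Fin 2) (Fin 2) ℂ → ℂ) =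
      fun A => A 0 0 * A 1 1 - A 0 1 * A 1 0 := funext Matrix.det_fin_two
  rw [hdet]
  exact ((hentry 0 0).mul (hentry 1 1)).sub ((hentry 0 1).mul (hentry 1 0))

end L2OpNorm

section CircleAverage

variable {E : Type*} [NormedAddCommGroup E] [NormedSpace ℂ E] {s : ℝ}

theorem norm_circleAverage_le (f : ℂ → E) (c : ℂ) (R : ℝ) :
    ‖Real.circleAverage f c R‖ ≤ Real.circleAverage (fun z => ‖f z‖) c R := by
  rw [Real.circleAverage_def, Real.circleAverage_def, norm_smul, smul_eq_mul,
    Real.norm_of_nonneg (by positivity)]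
  exact mul_le_mul_of_nonneg_left
    (intervalIntegral.norm_integral_le_integral_norm Real.two_pi_pos.le) (by positivity)

theorem sq_circleAverage_le {h : ℂ → ℝ} {c : ℂ} {R : ℝ} (hh : ContinuousOn h (sphere c |R|)) :
    Real.circleAverage h c R ^ 2 ≤ Real.circleAverage (fun z => h z ^ 2) c R := by
  set a := Real.circleAverage h c R with ha
  have hint {g : ℂ → ℝ} (hg : ContinuousOn g (sphere c |R|)) : CircleIntegrable g c R :=
    hg.circleIntegrable'
  have hvariance : 0 ≤ Real.circleAverage (fun z => (h z - a) ^ 2) c R :=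
    Real.circleAverage_nonneg_of_nonneg fun z _ => sq_nonneg (h z - a)
  have hexpand : (fun z => (h z - a) ^ 2) = fun z => h z ^ 2 - (2 * a) • h z + a ^ 2 := by
    ext z; rw [smul_eq_mul]; ring
  rw [hexpand, Real.circleAverage_fun_add (hint (by fun_prop)) (hint (by fun_prop)),
    Real.circleAverage_fun_sub (hint (by fun_prop)) (hint (by fun_prop)),
    Real.circleAverage_fun_smul, ← ha, Real.circleAverage_const, smul_eq_mul] at hvariance
  linarith

theorem circleAverage_eq_of_differentiableOn_annulus {f : ℂ → E} {R₁ R₂ : ℝ} (h₁ : 0 < R₁)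
    (h₁₂ : R₁ ≤ R₂) (hf : ∀ z, R₁ ≤ ‖z‖ → ‖z‖ ≤ R₂ → DifferentiableAt ℂ f z) :
    Real.circleAverage f 0 R₂ = Real.circleAverage f 0 R₁ := by
  rw [Real.circleAverage_eq_circleIntegral h₁.ne',
    Real.circleAverage_eq_circleIntegral (h₁.trans_le h₁₂).ne']
  congr 1
  refine Complex.circleIntegral_sub_center_inv_smul_eq_of_differentiable_on_annulus_off_countable
    h₁ h₁₂ countable_empty (fun z hz => ?_) fun z hz => ?_
  · rw [Set.mem_sdiff, mem_closedBall_zero_iff, mem_ball_zero_iff, not_lt] at hz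
    exact (hf z hz.2 hz.1).continuousAt.continuousWithinAt
  · rw [sdiff_empty, Set.mem_sdiff, mem_ball_zero_iff, mem_closedBall_zero_iff, not_le] at hz
    exact hf z hz.2.le hz.1.le

variable [CompleteSpace E]

theorem norm_le_mul_circleAverage_norm {X : ℂ → E} (hs : 1 < s)
    (hX : DifferentiableOn ℂ X (closedBall 0 1)) {w : ℂ} (hw : ‖w‖ ≤ s⁻¹) :
    ‖X w‖ ≤ (1 - s⁻¹)⁻¹ * Real.circleAverage (fun z => ‖X z‖) 0 1 := by
  have hs1 : s⁻¹ < 1 := inv_lt_one_of_one_lt₀ hs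
  have hw1 : w ∈ ball (0 : ℂ) |1| := by
    rw [abs_one, mem_ball_zero_iff]; exact hw.trans_lt hs1
  have hXd : DiffContOnCl ℂ X (ball 0 |1|) := by
    rw [abs_one]; exact hX.diffContOnCl_ball subset_rfl
  have hcont : ContinuousOn X (sphere 0 |1|) := by
    rw [abs_one]; exact hX.continuousOn.mono sphere_subset_closedBall
  have hkernel {z : ℂ} (hz : z ∈ sphere (0 : ℂ) |1|) : 1 - s⁻¹ ≤ ‖z - w‖ := by
    rw [abs_one, mem_sphere_zero_iff_norm] at hz
    linarith [norm_sub_norm_le z w]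
  have hne {z : ℂ} (hz : z ∈ sphere (0 : ℂ) |1|) : z - w ≠ 0 :=
    norm_pos_iff.mp (by linarith [hkernel hz])
  have hkcont : ContinuousOn (fun z => ((z - 0) / (z - w)) • X z) (sphere 0 |1|) :=
    ((continuousOn_id.sub continuousOn_const).div (continuousOn_id.sub continuousOn_const)
      fun z hz => hne hz).smul hcont
  have hnormcont : ContinuousOn (fun z => (1 - s⁻¹)⁻¹ • ‖X z‖) (sphere 0 |1|) := by fun_prop
  rw [← smul_eq_mul, ← Real.circleAverage_fun_smul, ← hXd.circleAverage_smul_div hw1]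
  refine (norm_circleAverage_le _ 0 1).trans <| Real.circleAverage_mono
    hkcont.norm.circleIntegrable' hnormcont.circleIntegrable' fun z hz => ?_
  have hz1 : ‖z‖ = 1 := by rwa [abs_one, mem_sphere_zero_iff_norm] at hz
  rw [norm_smul, sub_zero, norm_div, hz1, one_div, smul_eq_mul]
  exact mul_le_mul_of_nonneg_right (inv_anti₀ (by linarith) (hkernel hz)) (norm_nonneg _)

theorem circleAverage_re_le_of_norm_sub_le {f g : ℂ → ℂ} {R₁ R₂ δ : ℝ} (h₁ : 0 < R₁)
    (h₁₂ : R₁ ≤ R₂) (hf : ∀ z, R₁ ≤ ‖z‖ → ‖z‖ ≤ R₂ → DifferentiableAt ℂ f z)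
    (hg : DifferentiableOn ℂ g (closedBall 0 R₁))
    (hfg : ∀ z ∈ sphere (0 : ℂ) R₁, ‖f z - g z‖ ≤ δ) :
    Real.circleAverage (fun z => (f z).re) 0 R₂ ≤ (g 0).re + δ := by
  have habs₁ : |R₁| = R₁ := abs_of_pos h₁
  have habs₂ : |R₂| = R₂ := abs_of_pos (h₁.trans_le h₁₂)
  have hf₂ : CircleIntegrable f 0 R₂ := ContinuousOn.circleIntegrable' fun z hz => by
    rw [habs₂, mem_sphere_zero_iff_norm] at hz
    exact (hf z (h₁₂.trans_eq hz.symm) hz.le).continuousAt.continuousWithinAt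
  have hf₁ : CircleIntegrable f 0 R₁ := ContinuousOn.circleIntegrable' fun z hz => by
    rw [habs₁, mem_sphere_zero_iff_norm] at hz
    exact (hf z hz.ge (hz.le.trans h₁₂)).continuousAt.continuousWithinAt
  have hg₁ : CircleIntegrable g 0 R₁ := ContinuousOn.circleIntegrable' (by
    rw [habs₁]; exact hg.continuousOn.mono sphere_subset_closedBall)
  have hre : Real.circleAverage (fun z => (f z).re) 0 R₂ = (Real.circleAverage f 0 R₂).re :=
    Complex.reCLM.circleAverage_comp_comm hf₂
  have hg0 : Real.circleAverage g 0 R₁ = g 0 :=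
    DiffContOnCl.circleAverage (by rw [habs₁]; exact hg.diffContOnCl_ball subset_rfl)
  have hdist : ‖Real.circleAverage (f - g) 0 R₁‖ ≤ δ :=
    (norm_circleAverage_le _ 0 R₁).trans <|
      Real.circleAverage_mono_on_of_le_circle (hf₁.sub hg₁).norm (by rwa [habs₁])
  rw [Real.circleAverage_sub hf₁ hg₁, hg0] at hdist
  rw [hre, circleAverage_eq_of_differentiableOn_annulus h₁ h₁₂ hf]
  have := (Complex.re_le_norm _).trans hdist
  rw [Complex.sub_re] at this
  linarith

end CircleAverage

/-! ### The Sym factor and rigidity of the residue -/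

theorem differentiableOn_conjTranspose_inv_conj {ρ : ℝ} (hρ : 1 < ρ)
    {N : ℂ → Matrix (Fin 2) (Fin 2) ℂ} (hN : DifferentiableOn ℂ N (openAnnulus ρ)) :
    DifferentiableOn ℂ (fun z => (N (conj z)⁻¹).conjTranspose) (openAnnulus ρ) := by
  intro z hz
  have hz0 : conj z ≠ 0 := (map_ne_zero _).mpr (ne_zero_of_mem_openAnnulus hρ hz)
  have hinv : DifferentiableAt ℂ (fun u => N u⁻¹) (conj z) :=
    DifferentiableAt.comp (g := N) _
      (hN.differentiableAt ((isOpen_openAnnulus ρ).mem_nhds (inv_conj_mem_openAnnulus hρ hz)))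
      (differentiableAt_inv hz0)
  have hstar := hinv.star_conj
  rw [Complex.conj_conj] at hstar
  exact hstar.differentiableWithinAt

theorem conjTranspose_inv_conj_eq_neg {ρ : ℝ} (hρ : 1 < ρ) {N : ℂ → Matrix (Fin 2) (Fin 2) ℂ}
    (hN : DifferentiableOn ℂ N (openAnnulus ρ))
    (hskew : ∀ z ∈ sphere (0 : ℂ) 1, (N z).conjTranspose = -N z) {z : ℂ}
    (hz : z ∈ openAnnulus ρ) : (N (conj z)⁻¹).conjTranspose = -N z :=
  eqOn_openAnnulus_of_eqOn_sphere hρ (differentiableOn_conjTranspose_inv_conj hρ hN) hN.neg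
    (fun w hw => by simp only [inv_conj_eq_self hw, hskew w hw, Pi.neg_apply]) hz

theorem exists_eq_smul_of_zeros {E : Type*} [NormedAddCommGroup E] [NormedSpace ℂ E]
    [CompleteSpace E] {U : Set ℂ} (hU : IsOpen U) {f : ℂ → E} {l₁ l₂ : ℂ}
    (hf : DifferentiableOn ℂ f U) (h₁U : l₁ ∈ U) (h₂U : l₂ ∈ U) (h₁ : f l₁ = 0)
    (h₂ : l₂ ≠ l₁ → f l₂ = 0) (h₁₂ : l₂ = l₁ → HasDerivAt f 0 l₁) :
    ∃ g : ℂ → E, DifferentiableOn ℂ g U ∧ ∀ z, f z = ((z - l₁) * (z - l₂)) • g z := by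
  have hd : DifferentiableOn ℂ (dslope f l₁) U :=
    (Complex.differentiableOn_dslope (hU.mem_nhds h₁U)).mpr hf
  have hzero : dslope f l₁ l₂ = 0 := by
    by_cases h : l₂ = l₁
    · rw [h, dslope_same, (h₁₂ h).deriv]
    · have hsub := sub_smul_dslope f l₁ l₂
      rw [h₁, h₂ h, sub_zero, smul_eq_zero] at hsub
      exact hsub.resolve_left (sub_ne_zero.mpr h)
  refine ⟨dslope (dslope f l₁) l₂,
    (Complex.differentiableOn_dslope (hU.mem_nhds h₂U)).mpr hd, fun z => ?_⟩
  rw [mul_smul, sub_smul_dslope, hzero, sub_zero, sub_smul_dslope, h₁, sub_zero]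

/-- The function `e^{-iθ} λ⁻¹ (λ - l₁) (λ - l₂)`, which vanishes at the Sym points `l₁`, `l₂` and
is real on the unit circle. -/
noncomputable def symFactor (θ : ℝ) (l₁ l₂ z : ℂ) : ℂ :=
  Complex.exp (-θ * I) * z⁻¹ * ((z - l₁) * (z - l₂))

section SymFactor

variable {θ : ℝ} {l₁ l₂ z : ℂ}

theorem conj_symFactor (hsum : ∃ s : ℝ, l₁ + l₂ = Complex.exp (θ * I) * s)
    (hprod : l₁ * l₂ = Complex.exp (2 * θ * I)) (hz : z ∈ sphere (0 : ℂ) 1) :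
    conj (symFactor θ l₁ l₂ z) = symFactor θ l₁ l₂ z := by
  obtain ⟨s, hs⟩ := hsum
  have hz0 : z ≠ 0 := ne_zero_of_mem_unit_sphere ⟨z, hz⟩
  have hconjz : conj z = z⁻¹ := (Complex.inv_eq_conj (mem_sphere_zero_iff_norm.mp hz)).symm
  have hinv : Complex.exp (-θ * I) = (Complex.exp (θ * I))⁻¹ := by rw [← Complex.exp_neg, neg_mul]
  have hsq : Complex.exp (2 * θ * I) = Complex.exp (θ * I) ^ 2 := by
    rw [← Complex.exp_nat_mul]; ring_nf
  have hconj : conj (Complex.exp (θ * I)) = (Complex.exp (θ * I))⁻¹ := by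
    rw [← hinv, ← Complex.exp_conj]; simp
  have hω : Complex.exp (θ * I) ≠ 0 := Complex.exp_ne_zero _
  have hreal : symFactor θ l₁ l₂ z =
      (Complex.exp (θ * I))⁻¹ * z + Complex.exp (θ * I) * z⁻¹ - s := by
    have hquad : (z - l₁) * (z - l₂) = z ^ 2 - (l₁ + l₂) * z + l₁ * l₂ := by ring
    rw [symFactor, hquad, hs, hprod, hinv, hsq]
    field_simp
    ring
  rw [hreal]
  simp only [map_add, map_sub, map_mul, map_inv₀, hconj, hconjz, Complex.conj_ofReal, inv_inv]
  ring

theorem norm_exp_neg_mul_I (θ : ℝ) : ‖Complex.exp (-θ * I)‖ = 1 := by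
  rw [← Complex.ofReal_neg, Complex.norm_exp_ofReal_mul_I]

theorem norm_symFactor_le (hz : z ∈ sphere (0 : ℂ) 1) :
    ‖symFactor θ l₁ l₂ z‖ ≤ (1 + ‖l₁‖) * (1 + ‖l₂‖) := by
  rw [mem_sphere_zero_iff_norm] at hz
  rw [symFactor, norm_mul, norm_mul, norm_mul, norm_exp_neg_mul_I, norm_inv, hz, inv_one, one_mul,
    one_mul, ← hz]
  gcongr <;> exact norm_sub_le _ _

theorem eq_or_eq_of_symFactor_eq_zero (hz : z ≠ 0) (h : symFactor θ l₁ l₂ z = 0) :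
    z = l₁ ∨ z = l₂ := by
  simpa [symFactor, hz, sub_eq_zero] using h

end SymFactor

theorem circleAverage_norm_sq_eq {K : ℂ → Matrix (Fin 2) (Fin 2) ℂ} {S : Set ℂ} (hS : S.Finite)
    (hK : ∀ z ∈ sphere (0 : ℂ) 1 \ S, (K z).conjTranspose = -K z ∧ (K z).trace = 0) :
    Real.circleAverage (fun z => ‖K z‖ ^ 2) 0 1 =
      Real.circleAverage (fun z => (K z).det.re) 0 1 := by
  refine Real.circleAverage_congr_codiscreteWithin ?_ one_ne_zero
  rw [abs_one, EventuallyEq, Filter.Eventually,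
    codiscreteWithin_iff_locallyFiniteComplementWithin]
  refine fun _ _ => ⟨univ, univ_mem, hS.subset fun z hz => ?_⟩
  by_contra hzS
  obtain ⟨hskew, htrace⟩ := hK z ⟨hz.2.1, hzS⟩
  exact hz.2.2 (norm_sq_eq_re_det hskew htrace)

/-- `A` lies within `ε` of a conjugate of `B`, where the conjugating element and its inverse have
norm at most `κ`. The monodromy minus the identity is related in this way to the residue of the
potential. -/
def IsNearConj {𝔸 : Type*} [NormedRing 𝔸] (κ ε : ℝ) (A B : 𝔸) : Prop :=
  ∃ C C' : 𝔸, C * C' = 1 ∧ ‖C‖ ≤ κ ∧ ‖C'‖ ≤ κ ∧ ‖A - C * B * C'‖ ≤ ε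

theorem norm_mul_mul_le_sq_mul {𝔸 : Type*} [NormedRing 𝔸] {C B C' : 𝔸} {κ : ℝ}
    (hC : ‖C‖ ≤ κ) (hC' : ‖C'‖ ≤ κ) : ‖C * B * C'‖ ≤ κ ^ 2 * ‖B‖ := by
  have hκ : 0 ≤ κ := (norm_nonneg C).trans hC
  calc ‖C * B * C'‖ ≤ ‖C‖ * ‖B‖ * ‖C'‖ := norm_mul₃_le
    _ ≤ κ * ‖B‖ * κ := by gcongr
    _ = κ ^ 2 * ‖B‖ := by ring

namespace IsNearConj

variable {𝔸 : Type*} [NormedRing 𝔸] {A B : 𝔸} {κ ε : ℝ}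

theorem nonneg (h : IsNearConj κ ε A B) : 0 ≤ ε := by
  obtain ⟨C, C', -, -, -, h⟩ := h
  exact (norm_nonneg _).trans h

theorem mono {ε' : ℝ} (h : IsNearConj κ ε A B) (hε : ε ≤ ε') : IsNearConj κ ε' A B := by
  obtain ⟨C, C', hCC', hC, hC', h⟩ := h
  exact ⟨C, C', hCC', hC, hC', h.trans hε⟩

theorem norm_le (h : IsNearConj κ ε A B) : ‖A‖ ≤ κ ^ 2 * ‖B‖ + ε := by
  obtain ⟨C, C', -, hC, hC', h⟩ := h
  linarith [norm_sub_norm_le A (C * B * C'), norm_mul_mul_le_sq_mul (B := B) hC hC']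

variable {A B : Matrix (Fin 2) (Fin 2) ℂ}

theorem symm (h : IsNearConj κ ε A B) : IsNearConj κ (κ ^ 2 * ε) B A := by
  obtain ⟨C, C', hCC', hC, hC', h⟩ := h
  have hC'C : C' * C = 1 := mul_eq_one_comm.mp hCC'
  refine ⟨C', C, hC'C, hC', hC, ?_⟩
  have hB : C' * (C * B * C') * C = B := by
    rw [mul_assoc C B, ← mul_assoc, hC'C, one_mul, mul_assoc, hC'C, mul_one]
  have hsub : C' * A * C - B = C' * (A - C * B * C') * C := by rw [mul_sub, sub_mul, hB]
  rw [norm_sub_rev, hsub]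
  exact (norm_mul_mul_le_sq_mul hC' hC).trans (mul_le_mul_of_nonneg_left h (sq_nonneg κ))

theorem norm_det_sub_det_le (h : IsNearConj κ ε A B) :
    ‖A.det - B.det‖ ≤ 2 * ε * (2 * κ ^ 2 * ‖B‖ + ε) := by
  have hA := h.norm_le
  have hε := h.nonneg
  obtain ⟨C, C', hCC', hC, hC', h⟩ := h
  have hdet : (C * B * C').det = B.det := by
    rw [Matrix.det_mul_right_comm, hCC', Matrix.one_mul]
  rw [← hdet]
  refine (_root_.norm_det_sub_det_le A _).trans
    (mul_le_mul (by gcongr) ?_ (by positivity) (by positivity))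
  linarith [norm_mul_mul_le_sq_mul (B := B) hC hC']

end IsNearConj

section SymPoints

variable {s κ ε θ : ℝ} {l₁ l₂ : ℂ}

theorem norm_exp_two_mul_I (θ : ℝ) : ‖Complex.exp (2 * θ * I)‖ = 1 := by
  exact_mod_cast Complex.norm_exp_ofReal_mul_I (2 * θ)

theorem inv_lt_norm_of_mul_eq_exp (hs : 0 < s) (h₂ : ‖l₂‖ < s)
    (hprod : l₁ * l₂ = Complex.exp (2 * θ * I)) : s⁻¹ < ‖l₁‖ := by
  have hnorm : ‖l₁‖ * ‖l₂‖ = 1 := by rw [← norm_mul, hprod, norm_exp_two_mul_I]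
  have hl₂ : 0 < ‖l₂‖ := by
    refine (norm_nonneg l₂).lt_of_ne fun h => ?_
    rw [← h, mul_zero] at hnorm
    exact zero_ne_one hnorm
  rw [eq_inv_of_mul_eq_one_left hnorm]
  exact (inv_lt_inv₀ hs hl₂).mpr h₂

theorem norm_det_sub_le_of_symFactor_smul {N K X : Matrix (Fin 2) (Fin 2) ℂ} {z : ℂ} {d : ℝ}
    (hz : z ≠ 0) (hz1 : ‖z‖ ≤ 1) (hd : 0 < d) (hzd : d ≤ ‖(z - l₁) * (z - l₂)‖)
    (hN : N = symFactor θ l₁ l₂ z • K) (hnear : IsNearConj κ ε N (z⁻¹ • X)) :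
    ‖K.det - Complex.exp (2 * θ * I) / ((z - l₁) * (z - l₂)) ^ 2 * X.det‖ ≤
      2 * ε * (2 * κ ^ 2 * ‖z⁻¹ • X‖ + ε) / d ^ 2 := by
  obtain ⟨h₁, h₂⟩ := mul_ne_zero_iff.mp (norm_pos_iff.mp (hd.trans_le hzd))
  have hexp : Complex.exp (2 * θ * I) * Complex.exp (-θ * I) ^ 2 = 1 := by
    rw [← Complex.exp_nat_mul, ← Complex.exp_add, ← Complex.exp_zero]
    push_cast
    ring_nf
  have hfactor : K.det - Complex.exp (2 * θ * I) / ((z - l₁) * (z - l₂)) ^ 2 * X.det =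
      Complex.exp (2 * θ * I) * z ^ 2 / ((z - l₁) * (z - l₂)) ^ 2 *
        (N.det - (z⁻¹ • X).det) := by
    rw [hN, Matrix.det_smul, Matrix.det_smul, symFactor, Fintype.card_fin]
    generalize Complex.exp (-θ * I) = v at *
    field_simp
    linear_combination (-K.det) * ((z - l₁) * (z - l₂)) ^ 2 * hexp
  have hdet := hnear.norm_det_sub_det_le
  rw [hfactor, norm_mul, norm_div, norm_mul, norm_pow, norm_pow, norm_exp_two_mul_I, one_mul,
    div_mul_eq_mul_div]
  refine div_le_div₀ ((norm_nonneg _).trans hdet) ?_ (by positivity) (by gcongr)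
  exact (mul_le_of_le_one_left (norm_nonneg _) (pow_le_one₀ (norm_nonneg z) hz1)).trans hdet

end SymPoints

section Rigidity

variable {N K X : ℂ → Matrix (Fin 2) (Fin 2) ℂ} {s κ ε μ θ ρ : ℝ} {l₁ l₂ : ℂ}

theorem norm_sub_le_norm_sub_of_le {E : Type*} [SeminormedAddCommGroup E] {x y : E} {R : ℝ}
    (hx : ‖x‖ ≤ R) : ‖y‖ - R ≤ ‖x - y‖ := by
  linarith [norm_sub_norm_le y x, norm_sub_rev y x]

theorem differentiableOn_const_div_sq_mul {R : ℝ} (h₁ : R < ‖l₁‖) (h₂ : R < ‖l₂‖) (c : ℂ)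
    {f : ℂ → ℂ} (hf : DifferentiableOn ℂ f (closedBall 0 R)) :
    DifferentiableOn ℂ (fun z => c / ((z - l₁) * (z - l₂)) ^ 2 * f z) (closedBall 0 R) := by
  have hne {l z : ℂ} (hl : R < ‖l‖) (hz : z ∈ closedBall (0 : ℂ) R) : z - l ≠ 0 :=
    norm_pos_iff.mp <| (sub_pos.mpr hl).trans_le <|
      norm_sub_le_norm_sub_of_le (mem_closedBall_zero_iff.mp hz)
  have hp : DifferentiableOn ℂ (fun z => ((z - l₁) * (z - l₂)) ^ 2) (closedBall 0 R) := by
    fun_prop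
  exact ((differentiableOn_const c).div hp fun z hz =>
    pow_ne_zero 2 (mul_ne_zero (hne h₁ hz) (hne h₂ hz))).mul hf

theorem circleAverage_norm_sq_le (hs : 1 < s) (hsρ : s < ρ) (h₁ : s⁻¹ < ‖l₁‖) (h₂ : s⁻¹ < ‖l₂‖)
    (hprod : l₁ * l₂ = Complex.exp (2 * θ * I)) (hKd : DifferentiableOn ℂ K (openAnnulus ρ))
    (hK : ∀ z ∈ sphere (0 : ℂ) 1 \ {l₁, l₂}, (K z).conjTranspose = -K z ∧ (K z).trace = 0)
    (hNK : ∀ z ≠ 0, N z = symFactor θ l₁ l₂ z • K z) (hXd : DifferentiableOn ℂ X (closedBall 0 s))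
    (hX : ∀ z ∈ closedBall (0 : ℂ) s, ‖X z‖ ≤ μ)
    (hre : (Complex.exp (-2 * θ * I) * (X 0).det).re ≤ 0)
    (hnear : ∀ z, ‖z‖ = s⁻¹ → IsNearConj κ ε (N z) (z⁻¹ • X z)) :
    Real.circleAverage (fun z => ‖K z‖ ^ 2) 0 1 ≤
      2 * ε * (2 * κ ^ 2 * (s * μ) + ε) / ((‖l₁‖ - s⁻¹) * (‖l₂‖ - s⁻¹)) ^ 2 := by
  have hs0 : 0 < s := by linarith
  have hsinv : s⁻¹ < 1 := inv_lt_one_of_one_lt₀ hs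
  set g : ℂ → ℂ := fun z => Complex.exp (2 * θ * I) / ((z - l₁) * (z - l₂)) ^ 2 * (X z).det with hg
  have hg0 : g 0 = Complex.exp (-2 * θ * I) * (X 0).det := by
    rw [hg]
    simp only [zero_sub, neg_mul_neg, hprod]
    rw [show (-2 * θ * I : ℂ) = -(2 * θ * I) by ring, Complex.exp_neg, sq,
      div_mul_cancel_left₀ (Complex.exp_ne_zero _)]
  have hgd : DifferentiableOn ℂ g (closedBall 0 s⁻¹) :=
    differentiableOn_const_div_sq_mul h₁ h₂ _ <| differentiable_det.comp_differentiableOn <|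
      hXd.mono (closedBall_subset_closedBall (by linarith))
  rw [circleAverage_norm_sq_eq (toFinite _) hK]
  refine (circleAverage_re_le_of_norm_sub_le (f := fun z => (K z).det) (inv_pos.mpr hs0) hsinv.le
    (fun z hz₁ hz₂ => ?_) hgd fun z hz => ?_).trans (by rw [hg0]; exact add_le_of_nonpos_left hre)
  · have hz := mem_openAnnulus_of_le hs hsρ hz₁ (by linarith)
    exact (differentiable_det _).comp z (hKd.differentiableAt ((isOpen_openAnnulus ρ).mem_nhds hz))
  · rw [mem_sphere_zero_iff_norm] at hz
    have hz0 : z ≠ 0 := norm_pos_iff.mp (hz ▸ inv_pos.mpr hs0)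
    have hd : 0 < (‖l₁‖ - s⁻¹) * (‖l₂‖ - s⁻¹) := mul_pos (by linarith) (by linarith)
    have hzd : (‖l₁‖ - s⁻¹) * (‖l₂‖ - s⁻¹) ≤ ‖(z - l₁) * (z - l₂)‖ := by
      rw [norm_mul]
      exact mul_le_mul (norm_sub_le_norm_sub_of_le hz.le) (norm_sub_le_norm_sub_of_le hz.le)
        (by linarith) (norm_nonneg _)
    have hXz : ‖z⁻¹ • X z‖ ≤ s * μ := by
      rw [norm_smul, norm_inv, hz, inv_inv]
      exact mul_le_mul_of_nonneg_left (hX z (mem_closedBall_zero_iff.mpr (by linarith))) hs0.le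
    have hε : 0 ≤ ε := IsNearConj.nonneg (hnear z hz)
    refine (norm_det_sub_le_of_symFactor_smul hz0 (by linarith) hd hzd (hNK z hz0)
      (hnear z hz)).trans ?_
    gcongr

theorem norm_le_of_circleAverage_norm_sq_le (hs : 1 < s) {δ : ℝ}
    (hKc : ContinuousOn K (sphere 0 |1|)) (hNK : ∀ z ≠ 0, N z = symFactor θ l₁ l₂ z • K z)
    (hδ : Real.circleAverage (fun z => ‖K z‖ ^ 2) 0 1 ≤ δ)
    (hXd : DifferentiableOn ℂ X (closedBall 0 1))
    (hnear : ∀ z ∈ sphere (0 : ℂ) 1, IsNearConj κ ε (N z) (z⁻¹ • X z)) {w : ℂ} (hw : ‖w‖ ≤ s⁻¹) :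
    ‖X w‖ ≤ (1 - s⁻¹)⁻¹ * (κ ^ 2 * ((1 + ‖l₁‖) * (1 + ‖l₂‖) * √δ + ε)) := by
  have hXK : ∀ z ∈ sphere (0 : ℂ) |1|,
      ‖X z‖ ≤ κ ^ 2 * ((1 + ‖l₁‖) * (1 + ‖l₂‖) * ‖K z‖ + ε) := by
    intro z hz
    rw [abs_one] at hz
    have hXN := (hnear z hz).symm.norm_le
    rw [norm_smul, norm_inv, mem_sphere_zero_iff_norm.mp hz, inv_one, one_mul,
      hNK z (ne_zero_of_mem_unit_sphere ⟨z, hz⟩), norm_smul, ← mul_add] at hXN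
    refine hXN.trans ?_
    gcongr
    exact norm_symFactor_le hz
  have hXc : ContinuousOn X (sphere 0 |1|) := by
    rw [abs_one]
    exact hXd.continuousOn.mono sphere_subset_closedBall
  have haverage : Real.circleAverage (fun z => ‖K z‖) 0 1 ≤ √δ :=
    Real.le_sqrt_of_sq_le ((sq_circleAverage_le hKc.norm).trans hδ)
  have hKi : CircleIntegrable (fun z => ‖K z‖) 0 1 := hKc.norm.circleIntegrable'
  have hsinv : s⁻¹ < 1 := inv_lt_one_of_one_lt₀ hs
  refine (norm_le_mul_circleAverage_norm hs hXd hw).trans <|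
    mul_le_mul_of_nonneg_left ?_ (inv_nonneg.mpr (by linarith))
  calc Real.circleAverage (fun z => ‖X z‖) 0 1
      ≤ Real.circleAverage (fun z => κ ^ 2 • (((1 + ‖l₁‖) * (1 + ‖l₂‖)) • ‖K z‖ + ε)) 0 1 :=
        Real.circleAverage_mono hXc.norm.circleIntegrable'
          ((hKi.const_fun_smul.add (circleIntegrable_const ε 0 1)).const_fun_smul) hXK
    _ = κ ^ 2 * ((1 + ‖l₁‖) * (1 + ‖l₂‖) * Real.circleAverage (fun z => ‖K z‖) 0 1 + ε) := by
        rw [Real.circleAverage_fun_smul, Real.circleAverage_fun_add hKi.const_fun_smul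
          (circleIntegrable_const ε 0 1), Real.circleAverage_fun_smul, Real.circleAverage_const,
          smul_eq_mul, smul_eq_mul]
    _ ≤ κ ^ 2 * ((1 + ‖l₁‖) * (1 + ‖l₂‖) * √δ + ε) := by gcongr

theorem norm_le_of_norm_inv_le (hs : 1 < s) (hsρ : s < ρ) {n : ℝ}
    (hN : DifferentiableOn ℂ N (openAnnulus ρ))
    (hskew : ∀ z ∈ sphere (0 : ℂ) 1, (N z).conjTranspose = -N z)
    (hnear : ∀ z, s⁻¹ ≤ ‖z‖ → ‖z‖ ≤ s → IsNearConj κ ε (N z) (z⁻¹ • X z))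
    (hX : ∀ w : ℂ, ‖w‖ = s⁻¹ → ‖X w‖ ≤ n) {z : ℂ} (hz : ‖z‖ = s) :
    ‖X z‖ ≤ s * κ ^ 2 * (s * κ ^ 2 * n + 2 * ε) := by
  have hs0 : 0 < s := by linarith
  have hsinv : s⁻¹ < 1 := inv_lt_one_of_one_lt₀ hs
  have hw : ‖(conj z)⁻¹‖ = s⁻¹ := by rw [norm_inv, RCLike.norm_conj, hz]
  have hnear_w := hnear _ hw.ge (by linarith)
  have hnear_z := hnear z (by linarith) hz.le
  have hNz : ‖N z‖ = ‖N (conj z)⁻¹‖ := by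
    rw [← Matrix.l2_opNorm_conjTranspose (N (conj z)⁻¹), conjTranspose_inv_conj_eq_neg
      (hs.trans hsρ) hN hskew (mem_openAnnulus_of_le hs hsρ (by linarith) hz.le), norm_neg]
  have hNw : ‖N (conj z)⁻¹‖ ≤ κ ^ 2 * (s * n) + ε := by
    refine hnear_w.norm_le.trans ?_
    rw [norm_smul, norm_inv, hw, inv_inv]
    gcongr
    exact hX _ hw
  have hXN := hnear_z.symm.norm_le
  rw [norm_smul, norm_inv, hz, ← mul_add, inv_mul_le_iff₀ hs0, hNz] at hXN
  calc ‖X z‖ ≤ s * (κ ^ 2 * (‖N (conj z)⁻¹‖ + ε)) := hXN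
    _ ≤ s * (κ ^ 2 * (κ ^ 2 * (s * n) + ε + ε)) := by gcongr
    _ = s * κ ^ 2 * (s * κ ^ 2 * n + 2 * ε) := by ring

theorem exists_eq_symFactor_smul (h₁ : l₁ ∈ openAnnulus ρ) (h₂ : l₂ ∈ openAnnulus ρ)
    (hsum : ∃ x : ℝ, l₁ + l₂ = Complex.exp (θ * I) * x)
    (hprod : l₁ * l₂ = Complex.exp (2 * θ * I)) (hN : DifferentiableOn ℂ N (openAnnulus ρ))
    (hskew : ∀ z ∈ sphere (0 : ℂ) 1, (N z).conjTranspose = -N z)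
    (htrace : ∀ z ∈ sphere (0 : ℂ) 1, (N z).trace = 0)
    (hN₁ : N l₁ = 0) (hN₂ : l₂ ≠ l₁ → N l₂ = 0) (hN₁₂ : l₂ = l₁ → HasDerivAt N 0 l₁) :
    ∃ K : ℂ → Matrix (Fin 2) (Fin 2) ℂ, DifferentiableOn ℂ K (openAnnulus ρ) ∧
      (∀ z ≠ 0, N z = symFactor θ l₁ l₂ z • K z) ∧
      ∀ z ∈ sphere (0 : ℂ) 1 \ {l₁, l₂}, (K z).conjTranspose = -K z ∧ (K z).trace = 0 := by
  obtain ⟨G, hG, hNG⟩ :=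
    exists_eq_smul_of_zeros (isOpen_openAnnulus ρ) hN h₁ h₂ hN₁ hN₂ hN₁₂
  have hNK : ∀ z ≠ 0, N z = symFactor θ l₁ l₂ z • (Complex.exp (θ * I) * z) • G z := by
    intro z hz
    have hexp : Complex.exp (-θ * I) * Complex.exp (θ * I) = 1 := by
      rw [← Complex.exp_add, neg_mul, neg_add_cancel, Complex.exp_zero]
    rw [hNG z, smul_smul, symFactor]
    congr 1
    generalize Complex.exp (-θ * I) = u, Complex.exp (θ * I) = v at hexp
    field_simp
    linear_combination (-(z - l₁) * (z - l₂)) * hexp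
  refine ⟨fun z => (Complex.exp (θ * I) * z) • G z,
    (by fun_prop : DifferentiableOn ℂ (fun z => Complex.exp (θ * I) * z) _).smul hG, hNK,
    fun z ⟨hz, hzl⟩ => ?_⟩
  have hz0 : z ≠ 0 := ne_zero_of_mem_unit_sphere ⟨z, hz⟩
  have hp : symFactor θ l₁ l₂ z ≠ 0 := fun h => hzl (eq_or_eq_of_symFactor_eq_zero hz0 h)
  refine ⟨smul_right_injective _ hp ?_, ?_⟩
  · have hstar := hskew z hz
    rw [hNK z hz0, Matrix.conjTranspose_smul, ← starRingEnd_apply,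
      conj_symFactor hsum hprod hz] at hstar
    rwa [← smul_neg] at hstar
  · have htr := htrace z hz
    rw [hNK z hz0, Matrix.trace_smul, smul_eq_mul] at htr
    exact (mul_eq_zero.mp htr).resolve_left hp

/-- If the monodromy minus the identity is close to a conjugate of the residue up to a relative
error `ε`, then the residue is bounded by `contractionFactor s κ l₁ l₂ ε` times its own maximum. -/
noncomputable def contractionFactor (s κ : ℝ) (l₁ l₂ : ℂ) (ε : ℝ) : ℝ :=
  s * κ ^ 2 * (s * κ ^ 2 * ((1 - s⁻¹)⁻¹ * (κ ^ 2 * ((1 + ‖l₁‖) * (1 + ‖l₂‖) *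
    √(2 * ε * (2 * κ ^ 2 * s + ε) / ((‖l₁‖ - s⁻¹) * (‖l₂‖ - s⁻¹)) ^ 2) + ε))) + 2 * ε)

theorem contractionFactor_zero (s κ : ℝ) (l₁ l₂ : ℂ) : contractionFactor s κ l₁ l₂ 0 = 0 := by
  simp [contractionFactor]

theorem continuous_contractionFactor (s κ : ℝ) (l₁ l₂ : ℂ) :
    Continuous (contractionFactor s κ l₁ l₂) := by
  unfold contractionFactor
  simp only [div_eq_mul_inv]
  fun_prop

theorem norm_le_of_isNearConj (hs : 1 < s) (hsρ : s < ρ) (h₁ : s⁻¹ < ‖l₁‖) (h₂ : s⁻¹ < ‖l₂‖)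
    (hprod : l₁ * l₂ = Complex.exp (2 * θ * I)) (hN : DifferentiableOn ℂ N (openAnnulus ρ))
    (hskew : ∀ z ∈ sphere (0 : ℂ) 1, (N z).conjTranspose = -N z)
    (hKd : DifferentiableOn ℂ K (openAnnulus ρ)) (hNK : ∀ z ≠ 0, N z = symFactor θ l₁ l₂ z • K z)
    (hK : ∀ z ∈ sphere (0 : ℂ) 1 \ {l₁, l₂}, (K z).conjTranspose = -K z ∧ (K z).trace = 0)
    (hXd : DifferentiableOn ℂ X (closedBall 0 s)) (hX : ∀ z ∈ closedBall (0 : ℂ) s, ‖X z‖ ≤ μ)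
    (hre : (Complex.exp (-2 * θ * I) * (X 0).det).re ≤ 0)
    (hnear : ∀ z, s⁻¹ ≤ ‖z‖ → ‖z‖ ≤ s → IsNearConj κ (ε * μ) (N z) (z⁻¹ • X z)) {z : ℂ}
    (hz : ‖z‖ = s) :
    ‖X z‖ ≤ contractionFactor s κ l₁ l₂ ε * μ := by
  have hsinv : s⁻¹ < 1 := inv_lt_one_of_one_lt₀ hs
  have hμ : 0 ≤ μ := (norm_nonneg _).trans (hX 0 (mem_closedBall_self (by linarith)))
  have hmean := circleAverage_norm_sq_le hs hsρ h₁ h₂ hprod hKd hK hNK hXd hX hre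
    fun z hz => hnear z hz.ge (by linarith)
  have hKc : ContinuousOn K (sphere 0 |1|) := by
    rw [abs_one]
    exact hKd.continuousOn.mono (sphere_subset_openAnnulus (hs.trans hsρ))
  have hinner : ∀ w : ℂ, ‖w‖ = s⁻¹ → _ := fun w hw =>
    norm_le_of_circleAverage_norm_sq_le hs hKc hNK hmean
      (hXd.mono (closedBall_subset_closedBall hs.le))
      (fun z hz => hnear z (by rw [mem_sphere_zero_iff_norm.mp hz]; exact hsinv.le)
        (by rw [mem_sphere_zero_iff_norm.mp hz]; exact hs.le)) hw.le
  refine (norm_le_of_norm_inv_le hs hsρ hN hskew hnear hinner hz).trans_eq ?_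
  rw [show 2 * (ε * μ) * (2 * κ ^ 2 * (s * μ) + ε * μ) / ((‖l₁‖ - s⁻¹) * (‖l₂‖ - s⁻¹)) ^ 2 =
    2 * ε * (2 * κ ^ 2 * s + ε) / ((‖l₁‖ - s⁻¹) * (‖l₂‖ - s⁻¹)) ^ 2 * μ ^ 2 by ring,
    Real.sqrt_mul' _ (sq_nonneg μ), Real.sqrt_sq hμ, contractionFactor]
  ring

theorem exists_forall_eqOn_zero_of_isNearConj (hs : 1 < s) (hsρ : s < ρ) (h₁ : ‖l₁‖ < s)
    (h₂ : ‖l₂‖ < s) (hsum : ∃ x : ℝ, l₁ + l₂ = Complex.exp (θ * I) * x)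
    (hprod : l₁ * l₂ = Complex.exp (2 * θ * I)) (κ : ℝ) :
    ∃ ε > 0, ∀ N X : ℂ → Matrix (Fin 2) (Fin 2) ℂ, DifferentiableOn ℂ N (openAnnulus ρ) →
      (∀ z ∈ sphere (0 : ℂ) 1, (N z).conjTranspose = -N z) →
      (∀ z ∈ sphere (0 : ℂ) 1, (N z).trace = 0) →
      N l₁ = 0 → (l₂ ≠ l₁ → N l₂ = 0) → (l₂ = l₁ → HasDerivAt N 0 l₁) →
      DifferentiableOn ℂ X (closedBall 0 s) →
      (Complex.exp (-2 * θ * I) * (X 0).det).re ≤ 0 →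
      (∀ z, s⁻¹ ≤ ‖z‖ → ‖z‖ ≤ s → IsNearConj κ (ε * ‖X z‖) (N z) (z⁻¹ • X z)) →
      EqOn X 0 (closedBall 0 s) := by
  have hs0 : 0 < s := by linarith
  have h₁' := inv_lt_norm_of_mul_eq_exp hs0 h₂ hprod
  have h₂' := inv_lt_norm_of_mul_eq_exp hs0 h₁ (by rwa [mul_comm])
  obtain ⟨ε, hcε, hε⟩ : ∃ ε, contractionFactor s κ l₁ l₂ ε < 1 ∧ 0 < ε := by
    have hlim := (continuous_contractionFactor s κ l₁ l₂).tendsto' 0 0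
      (contractionFactor_zero s κ l₁ l₂)
    exact (((hlim.mono_left (nhdsWithin_le_nhds (s := Ioi 0))).eventually_lt_const one_pos).and
      self_mem_nhdsWithin).exists
  refine ⟨ε, hε, fun N X hN hskew htrace hN₁ hN₂ hN₁₂ hX hre hnear => ?_⟩
  obtain ⟨K, hKd, hNK, hK⟩ := exists_eq_symFactor_smul
    (mem_openAnnulus_of_le hs hsρ h₁'.le h₁.le) (mem_openAnnulus_of_le hs hsρ h₂'.le h₂.le)
    hsum hprod hN hskew htrace hN₁ hN₂ hN₁₂
  obtain ⟨z₀, hz₀, hmax⟩ := Complex.exists_mem_frontier_isMaxOn_norm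
    (isBounded_ball (x := (0 : ℂ)) (r := s)) ⟨0, mem_ball_self hs0⟩
    (hX.diffContOnCl_ball subset_rfl)
  rw [frontier_ball _ hs0.ne', mem_sphere_zero_iff_norm] at hz₀
  rw [closure_ball _ hs0.ne'] at hmax
  have hmax_le := norm_le_of_isNearConj hs hsρ h₁' h₂' hprod hN hskew hKd hNK hK hX
    (fun z hz => hmax hz) hre (fun z hz₁ hz₂ => (hnear z hz₁ hz₂).mono <|
      mul_le_mul_of_nonneg_left (hmax (mem_closedBall_zero_iff.mpr hz₂)) hε.le) hz₀
  have hzero : ‖X z₀‖ = 0 := by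
    rw [Function.comp_apply] at hmax_le
    nlinarith [norm_nonneg (X z₀)]
  exact fun z hz => norm_le_zero_iff.mp ((hmax hz).trans hzero.le)

end Rigidity

/-! ### The monodromy of a gauged linear equation -/

section NearConj

variable {𝔸 : Type*} [NormedRing 𝔸]

theorem norm_mul_mul_sub_mul_le [NormOneClass 𝔸] {T C Ψ x : 𝔸} {κ ε b : ℝ} (hC : ‖C‖ ≤ κ)
    (hT : ‖T - C‖ ≤ ε) (hΨ : ‖Ψ - 1‖ ≤ ε) (hε : ε ≤ 1) (hx : ‖x‖ ≤ b) :
    ‖T * x * Ψ - C * x‖ ≤ (2 + κ) * ε * b := by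
  have hκ : 0 ≤ κ := (norm_nonneg C).trans hC
  have hε₀ : 0 ≤ ε := (norm_nonneg _).trans hT
  have hb : 0 ≤ b := (norm_nonneg x).trans hx
  have hΨ2 : ‖Ψ‖ ≤ 2 := by
    have htri := norm_sub_norm_le Ψ 1
    rw [norm_one] at htri
    linarith
  have hsplit : T * x * Ψ - C * x = (T - C) * x * Ψ + C * x * (Ψ - 1) := by noncomm_ring
  calc ‖T * x * Ψ - C * x‖ ≤ ‖T - C‖ * ‖x‖ * ‖Ψ‖ + ‖C‖ * ‖x‖ * ‖Ψ - 1‖ := by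
        rw [hsplit]
        exact (norm_add_le _ _).trans (add_le_add norm_mul₃_le norm_mul₃_le)
    _ ≤ ε * b * 2 + κ * b * ε := by gcongr
    _ = (2 + κ) * ε * b := by ring

theorem isNearConj_of_norm_mul_sub_le {C C' D J V : 𝔸} {κ a b : ℝ} (hCC' : C * C' = 1)
    (hC : ‖C‖ ≤ κ) (hC' : ‖C'‖ ≤ κ) (hV : ‖V - C‖ ≤ a) (hJ : ‖J‖ ≤ b)
    (hDV : ‖D * V - C * J‖ ≤ a * b) (hκa : κ * a ≤ 1 / 2) :
    IsNearConj κ (2 * κ * (1 + κ ^ 2) * a * b) D J := by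
  have hκ : 0 ≤ κ := (norm_nonneg C).trans hC
  have ha : 0 ≤ a := (norm_nonneg _).trans hV
  have hb : 0 ≤ b := (norm_nonneg J).trans hJ
  have hsplit : D - C * J * C' = ((D * V - C * J) + D * (C - V)) * C' := by
    rw [mul_sub, sub_add_sub_cancel', sub_mul, mul_assoc D, hCC', mul_one]
  have hsub : ‖D - C * J * C'‖ ≤ (a * b + ‖D‖ * a) * κ := by
    rw [norm_sub_rev] at hV
    rw [hsplit]
    refine (norm_mul_le _ _).trans ?_
    gcongr
    exact (norm_add_le _ _).trans (add_le_add hDV ((norm_mul_le _ _).trans (by gcongr)))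
  have hDle : ‖D‖ ≤ (1 + 2 * κ ^ 2) * b := by
    have htri := norm_sub_norm_le D (C * J * C')
    have hCJ : ‖C * J * C'‖ ≤ κ ^ 2 * b :=
      (norm_mul_mul_le_sq_mul hC hC').trans (by gcongr)
    have habs : (a * b + ‖D‖ * a) * κ ≤ 1 / 2 * (b + ‖D‖) :=
      calc (a * b + ‖D‖ * a) * κ = κ * a * (b + ‖D‖) := by ring
        _ ≤ 1 / 2 * (b + ‖D‖) := by gcongr
    linarith
  refine ⟨C, C', hCC', hC, hC', ?_⟩
  calc ‖D - C * J * C'‖ ≤ (a * b + ‖D‖ * a) * κ := hsub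
    _ ≤ (a * b + (1 + 2 * κ ^ 2) * b * a) * κ := by gcongr
    _ = 2 * κ * (1 + κ ^ 2) * a * b := by ring

end NearConj

section LinearODE

variable {𝔸 : Type*} [NormedRing 𝔸] [NormedAlgebra ℂ 𝔸]

theorem exists_iterated_primitive [CompleteSpace 𝔸] [NormOneClass 𝔸] {A : ℂ → 𝔸} {e R : ℝ}
    (hA : DifferentiableOn ℂ A (ball 0 R)) (hAe : ∀ z ∈ ball (0 : ℂ) R, ‖A z‖ ≤ e) :
    ∃ φ : ℕ → ℂ → 𝔸, (∀ z, φ 0 z = 1) ∧ (∀ n, φ (n + 1) 0 = 0) ∧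
      (∀ n, ∀ z ∈ ball (0 : ℂ) R, HasDerivAt (φ (n + 1)) (A z * φ n z) z) ∧
      ∀ n, ∀ z ∈ ball (0 : ℂ) R, ‖φ n z‖ ≤ (e * R) ^ n := by
  have hprim (f : ℂ → 𝔸) : ∃ g : ℂ → 𝔸, DifferentiableOn ℂ f (ball 0 R) →
      g 0 = 0 ∧ ∀ z ∈ ball (0 : ℂ) R, HasDerivAt g (A z * f z) z := by
    by_cases hf : DifferentiableOn ℂ f (ball 0 R)
    · obtain ⟨g, hg⟩ := (hA.fun_mul hf).isExactOn_ball.with_val_at 0 0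
      exact ⟨g, fun _ => hg⟩
    · exact ⟨0, fun h => absurd h hf⟩
  choose P hP using hprim
  set φ : ℕ → ℂ → 𝔸 := fun n => P^[n] fun _ => 1 with hφ
  have hsucc (n : ℕ) : φ (n + 1) = P (φ n) := Function.iterate_succ_apply' ..
  have hdiff (n : ℕ) : DifferentiableOn ℂ (φ n) (ball 0 R) := by
    induction n with
    | zero => exact differentiableOn_const 1
    | succ n ih =>
      rw [hsucc]
      exact fun z hz => ((hP _ ih).2 z hz).differentiableAt.differentiableWithinAt
  have hderiv (n : ℕ) : ∀ z ∈ ball (0 : ℂ) R, HasDerivAt (φ (n + 1)) (A z * φ n z) z := by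
    rw [hsucc]
    exact (hP _ (hdiff n)).2
  have hzero (n : ℕ) : φ (n + 1) 0 = 0 := by
    rw [hsucc]
    exact (hP _ (hdiff n)).1
  refine ⟨φ, fun _ => rfl, hzero, hderiv, fun n => ?_⟩
  induction n with
  | zero => simp [hφ]
  | succ n ih =>
    intro z hz
    have hR : 0 < R := pos_of_mem_ball hz
    have he : 0 ≤ e := (norm_nonneg _).trans (hAe z hz)
    have hmean := (convex_ball (0 : ℂ) R).norm_image_sub_le_of_norm_hasDerivWithin_le
      (fun x hx => (hderiv n x hx).hasDerivWithinAt)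
      (fun x hx => (norm_mul_le _ _).trans
        (mul_le_mul (hAe x hx) (ih x hx) (norm_nonneg _) he)) (mem_ball_self hR) hz
    rw [hzero, sub_zero, sub_zero] at hmean
    calc ‖φ (n + 1) z‖ ≤ e * (e * R) ^ n * ‖z‖ := hmean
      _ ≤ e * (e * R) ^ n * R := by
        gcongr
        exact (mem_ball_zero_iff.mp hz).le
      _ = (e * R) ^ (n + 1) := by ring

theorem exists_hasDerivAt_mul_norm_sub_one_le [CompleteSpace 𝔸] [NormOneClass 𝔸] {A : ℂ → 𝔸}
    {e R : ℝ} (hR : 0 < R) (heR : e * R < 1) (hA : DifferentiableOn ℂ A (ball 0 R))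
    (hAe : ∀ z ∈ ball (0 : ℂ) R, ‖A z‖ ≤ e) :
    ∃ Ψ : ℂ → 𝔸, ∀ z ∈ ball (0 : ℂ) R, HasDerivAt Ψ (A z * Ψ z) z ∧
      ‖Ψ z - 1‖ ≤ e * R / (1 - e * R) := by
  have he : 0 ≤ e := (norm_nonneg _).trans (hAe 0 (mem_ball_self hR))
  have hgeom := hasSum_geometric_of_lt_one (by positivity) heR
  obtain ⟨φ, hφ₀, hφzero, hφ, hφle⟩ := exists_iterated_primitive hA hAe
  have hsum (z : ℂ) (hz : z ∈ ball (0 : ℂ) R) : Summable fun n => φ n z :=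
    hgeom.summable.of_norm_bounded fun n => hφle n z hz
  refine ⟨fun z => 1 + ∑' n, φ (n + 1) z, fun z hz => ⟨?_, ?_⟩⟩
  · have hderiv := hasDerivAt_tsum_of_isPreconnected (hgeom.summable.mul_left e) isOpen_ball
      (convex_ball (0 : ℂ) R).isPreconnected hφ
      (fun n x hx => (norm_mul_le _ _).trans
        (mul_le_mul (hAe x hx) (hφle n x hx) (norm_nonneg _) he))
      (mem_ball_self hR) (by simp only [hφzero, summable_zero]) hz
    refine (hderiv.const_add 1).congr_deriv ?_
    rw [(hsum z hz).tsum_mul_left, (hsum z hz).tsum_eq_zero_add, hφ₀]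
  · rw [add_sub_cancel_left, div_eq_mul_inv]
    refine tsum_of_norm_bounded (hgeom.mul_left (e * R)) fun n => ?_
    rw [← pow_succ']
    exact hφle (n + 1) z hz

theorem isNearConj_of_hasDerivAt [NormOneClass 𝔸] {C C' D : 𝔸} {T Ψ q Q : ℂ → 𝔸} {w₀ w₁ : ℂ}
    {κ ε p : ℝ} (hCC' : C * C' = 1) (hC : ‖C‖ ≤ κ) (hC' : ‖C'‖ ≤ κ)
    (hT : ∀ w ∈ segment ℝ w₀ w₁, ‖T w - C‖ ≤ ε) (hΨ : ∀ w ∈ segment ℝ w₀ w₁, ‖Ψ w - 1‖ ≤ ε)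
    (hV : ∀ w ∈ segment ℝ w₀ w₁, HasDerivAt (fun w => T w * Ψ w) (T w * q w * Ψ w) w)
    (hQ : ∀ w ∈ segment ℝ w₀ w₁, HasDerivAt Q (q w) w) (hq : ∀ w ∈ segment ℝ w₀ w₁, ‖q w‖ ≤ p)
    (hD : (1 + D) * (T w₀ * Ψ w₀) = T w₁ * Ψ w₁) (hε : ε ≤ 1) (hκε : κ * ((2 + κ) * ε) ≤ 1 / 2) :
    IsNearConj κ (2 * κ * (1 + κ ^ 2) * ((2 + κ) * ε) * (p * ‖w₁ - w₀‖)) D (Q w₁ - Q w₀) := by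
  have h₀ : w₀ ∈ segment ℝ w₀ w₁ := left_mem_segment ℝ w₀ w₁
  have h₁ : w₁ ∈ segment ℝ w₀ w₁ := right_mem_segment ℝ w₀ w₁
  have hclose := norm_mul_mul_sub_mul_le hC (hT w₀ h₀) (hΨ w₀ h₀) hε norm_one.le
  rw [mul_one, mul_one, mul_one] at hclose
  refine isNearConj_of_norm_mul_sub_le hCC' hC hC' hclose
    ((convex_segment w₀ w₁).norm_image_sub_le_of_norm_hasDerivWithin_le
      (fun w hw => (hQ w hw).hasDerivWithinAt) hq h₀ h₁) ?_ hκε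
  have hmean := (convex_segment w₀ w₁).norm_image_sub_le_of_norm_hasDerivWithin_le
    (fun w hw => ((hV w hw).fun_sub ((hQ w hw).const_mul C)).hasDerivWithinAt)
    (fun w hw => norm_mul_mul_sub_mul_le hC (hT w hw) (hΨ w hw) hε (hq w hw)) h₀ h₁
  have hsplit : D * (T w₀ * Ψ w₀) - C * (Q w₁ - Q w₀) =
      T w₁ * Ψ w₁ - C * Q w₁ - (T w₀ * Ψ w₀ - C * Q w₀) := by
    rw [← hD]
    noncomm_ring
  rw [hsplit, ← mul_assoc ((2 + κ) * ε)]
  exact hmean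

end LinearODE

section Gauge

/-- The coefficient `α z⁻²ᵐ⁻¹ + β z⁻ᵐ⁻¹ + γ z⁻¹` of the polar part of the potential. -/
noncomputable def principalPart (m : ℕ) (α β γ z : ℂ) : ℂ :=
  α / z ^ (2 * m + 1) + β / z ^ (m + 1) + γ / z

theorem mul_principalPart {z : ℂ} (hz : z ≠ 0) (m : ℕ) (α β γ : ℂ) :
    z * principalPart m α β γ z = α * z⁻¹ ^ (2 * m) + β * z⁻¹ ^ m + γ := by
  rw [principalPart, inv_pow, inv_pow, pow_succ, pow_succ]
  field_simp

theorem norm_mul_principalPart_le {z : ℂ} (hz : z ≠ 0) (m : ℕ) (α β γ : ℂ) :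
    ‖z * principalPart m α β γ z‖ ≤
      (‖z‖⁻¹ ^ (2 * m) + ‖z‖⁻¹ ^ m + 1) * (‖α‖ + ‖β‖ + ‖γ‖) := by
  rw [mul_principalPart hz]
  refine norm_add₃_le.trans ?_
  simp only [norm_mul, norm_pow, norm_inv]
  have h₁ : 0 ≤ ‖z‖⁻¹ ^ (2 * m) * (‖β‖ + ‖γ‖) := by positivity
  have h₂ : 0 ≤ ‖z‖⁻¹ ^ m * (‖α‖ + ‖γ‖) := by positivity
  linarith [norm_nonneg α, norm_nonneg β]

theorem norm_exp_of_mem_segment {w₀ w : ℂ} (hw : w ∈ segment ℝ w₀ (w₀ + 2 * Real.pi * I)) :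
    ‖Complex.exp w‖ = ‖Complex.exp w₀‖ := by
  rw [segment_eq_image'] at hw
  obtain ⟨τ, -, rfl⟩ := hw
  simp [Complex.norm_exp]

variable {𝔸 : Type*} [NormedRing 𝔸] [NormedAlgebra ℂ 𝔸]

/-- The coefficient of `z⁻¹` in the polar part `principalPart m α β γ z • E` after conjugation by
the gauge `1 + zᵐ F`, where `F² = 0`. -/
def gaugedResidue (E F : 𝔸) (α β γ : ℂ) : 𝔸 :=
  γ • E + β • (F * E - E * F) - α • (F * E * F)

theorem exists_primitive_exp_zpow_smul [CompleteSpace 𝔸] (n : ℤ) (v : 𝔸) :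
    ∃ Q : ℂ → 𝔸, (∀ w, HasDerivAt Q (Complex.exp w ^ n • v) w) ∧
      ∀ w, Q (w + 2 * Real.pi * I) - Q w = if n = 0 then (2 * Real.pi * I) • v else 0 := by
  rcases eq_or_ne n 0 with rfl | hn
  · refine ⟨fun w => w • v, fun w => ?_, fun w => ?_⟩
    · simpa using (hasDerivAt_id w).smul_const v
    · rw [if_pos rfl, ← sub_smul, add_sub_cancel_left]
  · refine ⟨fun w => Complex.exp (n * w) • (n : ℂ)⁻¹ • v, fun w => ?_, fun w => ?_⟩
    · have hderiv := ((hasDerivAt_mul_const (x := w) (n : ℂ)).cexp).smul_const ((n : ℂ)⁻¹ • v)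
      simp only [mul_comm _ (n : ℂ)] at hderiv
      refine hderiv.congr_deriv ?_
      rw [Complex.exp_int_mul, smul_smul, mul_comm, ← mul_assoc,
        inv_mul_cancel₀ (Int.cast_ne_zero.mpr hn), one_mul]
    · beta_reduce
      rw [if_neg hn, mul_add, Complex.exp_add, Complex.exp_int_mul_two_pi_mul_I, mul_one, sub_self]

theorem one_add_smul_mul_mul_one_sub_smul (E F : 𝔸) (x : ℂ) :
    (1 + x • F) * E * (1 - x • F) = E + x • (F * E - E * F) - x ^ 2 • (F * E * F) := by
  simp only [add_mul, mul_sub, mul_one, one_mul, smul_mul_assoc, mul_smul_comm]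
  module

theorem exists_primitive_gauged_principalPart [CompleteSpace 𝔸] {m : ℕ} (hm : m ≠ 0) (α β γ : ℂ)
    (E F : 𝔸) :
    ∃ Q : ℂ → 𝔸, (∀ w, HasDerivAt Q
      ((Complex.exp w * principalPart m α β γ (Complex.exp w)) •
        ((1 + Complex.exp w ^ m • F) * E * (1 - Complex.exp w ^ m • F))) w) ∧
      ∀ w, Q (w + 2 * Real.pi * I) - Q w = (2 * Real.pi * I) • gaugedResidue E F α β γ := by
  have hmz : (m : ℤ) ≠ 0 := Int.natCast_ne_zero.mpr hm
  have h2mz : (2 * m : ℤ) ≠ 0 := mul_ne_zero two_ne_zero hmz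
  choose P hP hPper using exists_primitive_exp_zpow_smul (𝔸 := 𝔸)
  refine ⟨fun w => P 0 (gaugedResidue E F α β γ) w + P (-(2 * m)) (α • E) w +
    P (-m) (α • (F * E - E * F) + β • E) w + P m (γ • (F * E - E * F) - β • (F * E * F)) w -
    P (2 * m) (γ • (F * E * F)) w, fun w => ?_, fun w => ?_⟩
  · refine (((((hP 0 _ w).fun_add (hP _ _ w)).fun_add (hP _ _ w)).fun_add (hP _ _ w)).fun_sub
      (hP _ _ w)).congr_deriv ?_
    have hx : Complex.exp w ^ m ≠ 0 := pow_ne_zero m (Complex.exp_ne_zero w)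
    have hcast : (2 * m : ℤ) = ((m * 2 : ℕ) : ℤ) := by push_cast; ring
    rw [mul_principalPart (Complex.exp_ne_zero w), one_add_smul_mul_mul_one_sub_smul,
      gaugedResidue, mul_comm 2 m, hcast]
    simp only [zpow_neg, zpow_natCast, zpow_zero, inv_pow, pow_mul]
    generalize Complex.exp w ^ m = x at hx
    match_scalars <;> field_simp <;> ring
  · have hper {n : ℤ} (hn : n ≠ 0) (v : 𝔸) : P n v (w + 2 * Real.pi * I) = P n v w := by
      rw [← sub_eq_zero, hPper, if_neg hn]
    have hzero := hPper 0 (gaugedResidue E F α β γ) w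
    rw [if_pos rfl] at hzero
    beta_reduce
    rw [hper (neg_ne_zero.mpr h2mz), hper (neg_ne_zero.mpr hmz), hper hmz, hper h2mz, ← hzero]
    abel

theorem one_sub_smul_mul_one_add_smul {F : 𝔸} (hF : F * F = 0) (x : ℂ) :
    (1 - x • F) * (1 + x • F) = 1 := by
  simp only [sub_mul, mul_add, mul_one, one_mul, smul_mul_assoc, mul_smul_comm, hF, smul_zero]
  module

theorem hasDerivAt_gauged_mul {F : 𝔸} (hF : F * F = 0) {E : 𝔸} {U Ψ Ξ : ℂ → 𝔸} {f : ℂ → ℂ}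
    {m : ℕ} {w : ℂ}
    (hU : HasDerivAt U
      (U w * (Complex.exp w • (f (Complex.exp w) • E + Ξ (Complex.exp w)))) w)
    (hΨ : HasDerivAt Ψ (-((1 + Complex.exp w ^ m • F) *
      (Ξ (Complex.exp w) - ((m : ℂ) * Complex.exp w ^ (m - 1)) • F) *
      (1 - Complex.exp w ^ m • F)) * Ψ (Complex.exp w)) (Complex.exp w)) :
    HasDerivAt (fun w => U w * (1 - Complex.exp w ^ m • F) * Ψ (Complex.exp w))
      (U w * (1 - Complex.exp w ^ m • F) * ((Complex.exp w * f (Complex.exp w)) •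
        ((1 + Complex.exp w ^ m • F) * E * (1 - Complex.exp w ^ m • F))) *
          Ψ (Complex.exp w)) w := by
  have hG : HasDerivAt (fun w => 1 - Complex.exp w ^ m • F) _ w :=
    (((Complex.hasDerivAt_exp w).fun_pow m).smul_const F).const_sub 1
  refine ((hU.fun_mul hG).fun_mul (hΨ.scomp w (Complex.hasDerivAt_exp w))).congr_deriv ?_
  have hcancel (y : 𝔸) :
      (1 - Complex.exp w ^ m • F) * ((1 + Complex.exp w ^ m • F) * y) = y := by
    rw [← mul_assoc, one_sub_smul_mul_one_add_smul hF, one_mul]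
  have hFG (y : 𝔸) : F * ((1 - Complex.exp w ^ m • F) * y) = F * y := by
    rw [← mul_assoc, mul_sub, mul_smul_comm, hF, smul_zero, sub_zero, mul_one]
  generalize 1 - Complex.exp w ^ m • F = G' at *
  generalize 1 + Complex.exp w ^ m • F = G at *
  simp only [mul_add, mul_sub, add_mul, sub_mul, mul_neg, neg_mul, mul_smul_comm, smul_mul_assoc,
    mul_assoc, hcancel, hFG, smul_add, smul_neg, smul_sub, Function.comp_apply]
  module

variable [NormOneClass 𝔸]

theorem norm_one_add_smul_mul_mul_one_sub_smul_le {x : ℂ} {b : ℝ} (hx : ‖x‖ ≤ b) (B F : 𝔸) :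
    ‖(1 + x • F) * B * (1 - x • F)‖ ≤ (1 + b * ‖F‖) ^ 2 * ‖B‖ := by
  have hxF : ‖x • F‖ ≤ b * ‖F‖ := by
    rw [norm_smul]
    gcongr
  refine norm_mul_mul_le_sq_mul ((norm_add_le _ _).trans ?_) ((norm_sub_le _ _).trans ?_) <;>
    rw [norm_one] <;> gcongr

theorem exists_gauge_correction [CompleteSpace 𝔸] {Θ : ℂ → 𝔸} {m : ℕ} {F : 𝔸} {ε r R : ℝ}
    (hR : 0 < R) (hRr : R < r) (hΘ : DifferentiableOn ℂ Θ (ball 0 r))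
    (hΘε : ∀ z ∈ sphere (0 : ℂ) R, ‖Θ z‖ ≤ ε)
    (hε : (1 + R ^ m * ‖F‖) ^ 2 * R * ε ≤ 1 / 2) :
    ∃ Ψ : ℂ → 𝔸, ∀ z ∈ ball (0 : ℂ) R,
      HasDerivAt Ψ (-((1 + z ^ m • F) * Θ z * (1 - z ^ m • F)) * Ψ z) z ∧
      ‖Ψ z - 1‖ ≤ 2 * ((1 + R ^ m * ‖F‖) ^ 2 * R * ε) := by
  have hΘball (z : ℂ) (hz : z ∈ ball (0 : ℂ) R) : ‖Θ z‖ ≤ ε := by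
    refine norm_le_of_forall_mem_frontier_norm_le isBounded_ball ?_ ?_ (subset_closure hz)
    · exact (hΘ.mono (closedBall_subset_ball hRr)).diffContOnCl_ball Subset.rfl
    · rwa [frontier_ball _ hR.ne']
  have hε₀ : 0 ≤ ε := (norm_nonneg _).trans (hΘball 0 (mem_ball_self hR))
  have hdiff : DifferentiableOn ℂ (fun z => -((1 + z ^ m • F) * Θ z * (1 - z ^ m • F)))
      (ball 0 R) := by
    have hΘ' := hΘ.mono (ball_subset_ball hRr.le)
    fun_prop
  obtain ⟨Ψ, hΨ⟩ := exists_hasDerivAt_mul_norm_sub_one_le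
    (e := (1 + R ^ m * ‖F‖) ^ 2 * ε) hR (by linarith) hdiff fun z hz => by
      have hzm : ‖z ^ m‖ ≤ R ^ m := by
        rw [norm_pow]
        gcongr
        exact (mem_ball_zero_iff.mp hz).le
      rw [norm_neg]
      refine (norm_one_add_smul_mul_mul_one_sub_smul_le hzm _ _).trans ?_
      gcongr
      exact hΘball z hz
  refine ⟨Ψ, fun z hz => ⟨(hΨ z hz).1, (hΨ z hz).2.trans ?_⟩⟩
  rw [mul_right_comm] at hε ⊢
  rw [div_le_iff₀ (by linarith)]
  nlinarith [show 0 ≤ (1 + R ^ m * ‖F‖) ^ 2 * ε * R by positivity]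

theorem norm_gauged_principalPart_le {R : ℝ} {z : ℂ} (hz : z ≠ 0) (hzR : ‖z‖ ≤ R) (m : ℕ)
    (α β γ : ℂ) (E F : 𝔸) :
    ‖(z * principalPart m α β γ z) • ((1 + z ^ m • F) * E * (1 - z ^ m • F))‖ ≤
      (‖z‖⁻¹ ^ (2 * m) + ‖z‖⁻¹ ^ m + 1) * ((1 + R ^ m * ‖F‖) ^ 2 * ‖E‖) *
        (‖α‖ + ‖β‖ + ‖γ‖) := by
  have hzm : ‖z ^ m‖ ≤ R ^ m := by
    rw [norm_pow]
    gcongr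
  rw [norm_smul, mul_right_comm]
  exact mul_le_mul (norm_mul_principalPart_le hz m α β γ)
    (norm_one_add_smul_mul_mul_one_sub_smul_le hzm E F) (norm_nonneg _) (by positivity)

theorem isNearConj_gaugedResidue [CompleteSpace 𝔸] {m : ℕ} (hm : m ≠ 0) {w₀ : ℂ}
    {r R κ ε δ : ℝ} (hw₀R : ‖Complex.exp w₀‖ < R) (hRr : R < r) {E F : 𝔸} (hF : F * F = 0)
    {C C' D : 𝔸} {U Ξ : ℂ → 𝔸} {α β γ : ℂ} (hCC' : C * C' = 1) (hC : ‖C‖ ≤ κ) (hC' : ‖C'‖ ≤ κ)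
    (hΞ : DifferentiableOn ℂ Ξ (ball 0 r))
    (hU : ∀ w ∈ segment ℝ w₀ (w₀ + 2 * Real.pi * I), HasDerivAt U (U w * (Complex.exp w •
      (principalPart m α β γ (Complex.exp w) • E + Ξ (Complex.exp w)))) w)
    (hΞε : ∀ z ∈ sphere (0 : ℂ) R, ‖Ξ z - ((m : ℂ) * z ^ (m - 1)) • F‖ ≤ ε)
    (hUε : ∀ w ∈ segment ℝ w₀ (w₀ + 2 * Real.pi * I),
      ‖U w * (1 - Complex.exp w ^ m • F) - C‖ ≤ δ)
    (hD : (1 + D) * U w₀ = U (w₀ + 2 * Real.pi * I))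
    (hεδ : 2 * ((1 + R ^ m * ‖F‖) ^ 2 * R * ε) ≤ δ) (hδ : δ ≤ 1)
    (hκδ : κ * ((2 + κ) * δ) ≤ 1 / 2) :
    IsNearConj κ (2 * κ * (1 + κ ^ 2) * ((2 + κ) * δ) *
      ((‖Complex.exp w₀‖⁻¹ ^ (2 * m) + ‖Complex.exp w₀‖⁻¹ ^ m + 1) *
        ((1 + R ^ m * ‖F‖) ^ 2 * ‖E‖) * (‖α‖ + ‖β‖ + ‖γ‖) * (2 * Real.pi))) D
      ((2 * Real.pi * I) • gaugedResidue E F α β γ) := by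
  have hR : 0 < R := (norm_nonneg _).trans_lt hw₀R
  have hΘ : DifferentiableOn ℂ (fun z => Ξ z - ((m : ℂ) * z ^ (m - 1)) • F) (ball 0 r) := by
    fun_prop
  obtain ⟨Ψ, hΨ⟩ := exists_gauge_correction (m := m) (F := F) hR hRr hΘ hΞε (by linarith)
  obtain ⟨Q, hQ, hQper⟩ := exists_primitive_gauged_principalPart hm α β γ E F
  have hball {w : ℂ} (hw : w ∈ segment ℝ w₀ (w₀ + 2 * Real.pi * I)) :
      Complex.exp w ∈ ball (0 : ℂ) R := by
    rwa [mem_ball_zero_iff, norm_exp_of_mem_segment hw]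
  have hlength : ‖w₀ + 2 * Real.pi * I - w₀‖ = 2 * Real.pi := by
    simp [abs_of_pos Real.pi_pos]
  have hexp : Complex.exp (w₀ + 2 * Real.pi * I) = Complex.exp w₀ := Complex.exp_periodic w₀
  rw [← hQper w₀, ← hlength]
  refine isNearConj_of_hasDerivAt (T := fun w => U w * (1 - Complex.exp w ^ m • F))
    (Ψ := fun w => Ψ (Complex.exp w)) hCC' hC hC' hUε
    (fun w hw => ((hΨ _ (hball hw)).2).trans hεδ)
    (fun w hw => hasDerivAt_gauged_mul hF (hU w hw) (hΨ _ (hball hw)).1)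
    (fun w _ => hQ w) (fun w hw => ?_) ?_ hδ hκδ
  · rw [← norm_exp_of_mem_segment hw]
    exact norm_gauged_principalPart_le (Complex.exp_ne_zero w)
      (mem_ball_zero_iff.mp (hball hw)).le m α β γ E F
  · rw [hexp, ← hD]
    simp only [mul_assoc]

end Gauge

/-! ### The polar part of the potential -/

section PrincipalPart

variable {V : Type*} [NormedAddCommGroup V] [NormedSpace ℂ V] [CompleteSpace V]
  {m : ℕ} {R r e : ℝ} {h : ℂ → V} {α β γ : ℂ} {v : V}

theorem pow_mul_principalPart {z : ℂ} (hz : z ≠ 0) (m j : ℕ) (α β γ : ℂ) :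
    z ^ j * principalPart m α β γ z =
      z ^ ((j : ℤ) - (2 * m + 1)) * α + z ^ ((j : ℤ) - (m + 1)) * β + z ^ ((j : ℤ) - 1) * γ := by
  simp only [principalPart, zpow_sub₀ hz, zpow_natCast, zpow_add₀ hz, zpow_mul, pow_mul,
    pow_succ, zpow_ofNat]
  field_simp

theorem circleIntegral_pow_smul_principalPart_add (hR : 0 < R) (hRr : R < r)
    (hh : DifferentiableOn ℂ h (ball 0 r)) (j : ℕ) :
    (∮ z in C(0, R), z ^ j • (principalPart m α β γ z • v + h z)) =
      (2 * Real.pi * I) • ((if j = 2 * m then α else 0) + (if j = m then β else 0) +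
        (if j = 0 then γ else 0)) • v := by
  have hsub : closedBall (0 : ℂ) R ⊆ ball 0 r := closedBall_subset_ball hRr
  have hd : DifferentiableOn ℂ (fun z => z ^ j • h z) (ball 0 r) := by fun_prop
  have hholo : (∮ z in C(0, R), z ^ j • h z) = 0 :=
    (hd.diffContOnCl_ball hsub).circleIntegral_eq_zero hR.le
  have hint : CircleIntegrable (fun z => z ^ j • h z) 0 R :=
    (hd.continuousOn.mono (sphere_subset_closedBall.trans hsub)).circleIntegrable hR.le
  have hzpow (k : ℤ) (x : V) : CircleIntegrable (fun z => z ^ k • x) 0 R :=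
    ContinuousOn.circleIntegrable hR.le fun z hz => ((continuousAt_zpow₀ z k
      (Or.inl (ne_of_mem_sphere hz hR.ne'))).smul continuousAt_const).continuousWithinAt
  have hmoment (k : ℤ) (x : V) : (∮ z in C(0, R), z ^ k • x) =
      (2 * Real.pi * I) • if k = -1 then x else 0 := by
    rw [circleIntegral.integral_smul_const, circleIntegral_zpow hR.ne']
    split_ifs <;> simp
  calc (∮ z in C(0, R), z ^ j • (principalPart m α β γ z • v + h z))
      = ∮ z in C(0, R), (z ^ ((j : ℤ) - (2 * m + 1)) • α • v + z ^ ((j : ℤ) - (m + 1)) • β • v +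
          z ^ ((j : ℤ) - 1) • γ • v + z ^ j • h z) :=
        circleIntegral.integral_congr hR.le fun z hz => by
          simp only [smul_add, smul_smul, ← add_smul,
            pow_mul_principalPart (ne_of_mem_sphere hz hR.ne')]
    _ = _ := by
        rw [circleIntegral.integral_add
            (((hzpow _ _).fun_add (hzpow _ _)).fun_add (hzpow _ _)) hint,
          circleIntegral.integral_add ((hzpow _ _).fun_add (hzpow _ _)) (hzpow _ _),
          circleIntegral.integral_add (hzpow _ _) (hzpow _ _), hholo, add_zero]
        simp only [hmoment, ← smul_add, add_smul, ite_smul, zero_smul,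
          show (j : ℤ) - (2 * m + 1) = -1 ↔ j = 2 * m by lia,
          show (j : ℤ) - (m + 1) = -1 ↔ j = m by lia, show (j : ℤ) - 1 = -1 ↔ j = 0 by lia]

theorem norm_smul_le_of_norm_principalPart_smul_add_le (hm : m ≠ 0) (hR : 0 < R) (hRr : R < r)
    (hh : DifferentiableOn ℂ h (ball 0 r))
    (hb : ∀ z ∈ sphere (0 : ℂ) R, ‖principalPart m α β γ z • v + h z‖ ≤ e) :
    ‖α • v‖ ≤ R ^ (2 * m + 1) * e ∧ ‖β • v‖ ≤ R ^ (m + 1) * e ∧ ‖γ • v‖ ≤ R * e := by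
  have hmoment (j : ℕ) : ‖((if j = 2 * m then α else 0) + (if j = m then β else 0) +
      (if j = 0 then γ else 0)) • v‖ ≤ R ^ (j + 1) * e := by
    have hint := circleIntegral.norm_integral_le_of_norm_le_const (c := 0) (C := R ^ j * e)
      (f := fun z => z ^ j • (principalPart m α β γ z • v + h z)) hR.le fun z hz => by
        rw [norm_smul, norm_pow, mem_sphere_zero_iff_norm.mp hz]
        exact mul_le_mul_of_nonneg_left (hb z hz) (by positivity)
    rw [circleIntegral_pow_smul_principalPart_add hR hRr hh, norm_smul] at hint
    refine le_of_mul_le_mul_left (a := 2 * Real.pi) ?_ Real.two_pi_pos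
    refine (le_of_eq_of_le ?_ hint).trans_eq (by ring)
    simp [abs_of_pos Real.pi_pos]
  refine ⟨?_, ?_, ?_⟩
  · simpa [hm, show 2 * m ≠ m by lia] using hmoment (2 * m)
  · simpa [hm, show m ≠ 2 * m by lia] using hmoment m
  · simpa [hm, hm.symm] using hmoment 0

theorem norm_le_of_norm_principalPart_smul_add_le (hm : m ≠ 0) (hR : 0 < R) (hRr : R < r)
    (hh : DifferentiableOn ℂ h (ball 0 r))
    (hb : ∀ z ∈ sphere (0 : ℂ) R, ‖principalPart m α β γ z • v + h z‖ ≤ e) {z : ℂ}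
    (hz : z ∈ sphere 0 R) :
    ‖h z‖ ≤ 4 * e := by
  obtain ⟨hα, hβ, hγ⟩ := norm_smul_le_of_norm_principalPart_smul_add_le hm hR hRr hh hb
  have hnorm : ‖z‖ = R := mem_sphere_zero_iff_norm.mp hz
  have hprincipal : ‖principalPart m α β γ z • v‖ ≤ 3 * e := by
    rw [principalPart, add_smul, add_smul]
    simp only [div_eq_inv_mul, mul_smul]
    refine norm_add₃_le.trans ?_
    simp only [norm_smul _ (_ • v), norm_inv, norm_pow, hnorm]
    have hα' := (inv_mul_le_iff₀ (by positivity)).mpr hα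
    have hβ' := (inv_mul_le_iff₀ (by positivity)).mpr hβ
    have hγ' := (inv_mul_le_iff₀ hR).mpr hγ
    linarith
  have hsub := norm_sub_le (principalPart m α β γ z • v + h z) (principalPart m α β γ z • v)
  rw [add_sub_cancel_left] at hsub
  linarith [hb z hz]

end PrincipalPart

section Cover

variable {r : ℝ}

theorem isOpen_puncturedDisc (r : ℝ) : IsOpen (puncturedDisc r) :=
  isOpen_ball.sdiff isClosed_singleton

theorem isOpen_coverOfPuncturedDisc (r : ℝ) : IsOpen (coverOfPuncturedDisc r) :=
  (isOpen_puncturedDisc r).preimage Complex.continuous_exp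

theorem mem_coverOfPuncturedDisc {w : ℂ} : w ∈ coverOfPuncturedDisc r ↔ ‖Complex.exp w‖ < r := by
  simp [coverOfPuncturedDisc, puncturedDisc]

theorem sphere_subset_puncturedDisc {R : ℝ} (hR : 0 < R) (hRr : R < r) :
    sphere (0 : ℂ) R ⊆ puncturedDisc r := fun _ hz =>
  ⟨(sphere_subset_closedBall.trans (closedBall_subset_ball hRr)) hz, ne_of_mem_sphere hz hR.ne'⟩

theorem segment_subset_coverOfPuncturedDisc {w₀ : ℂ} (hw₀ : w₀ ∈ coverOfPuncturedDisc r) :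
    segment ℝ w₀ (w₀ + 2 * Real.pi * I) ⊆ coverOfPuncturedDisc r := fun w hw => by
  rwa [mem_coverOfPuncturedDisc, norm_exp_of_mem_segment hw, ← mem_coverOfPuncturedDisc]

end Cover

theorem eventually_forall_norm_sub_le {X Y E : Type*} [TopologicalSpace X] [TopologicalSpace Y]
    [SeminormedAddCommGroup E] {f : X × Y → E} {I : Set X} {U K : Set Y} {x₀ : X} (hI : I ∈ 𝓝 x₀)
    (hU : IsOpen U) (hf : ContinuousOn f (I ×ˢ U)) (hK : IsCompact K) (hKU : K ⊆ U) {e : ℝ}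
    (he : 0 < e) :
    ∀ᶠ x in 𝓝 x₀, ∀ y ∈ K, ‖f (x, y) - f (x₀, y)‖ ≤ e := by
  refine hK.eventually_forall_of_forall_eventually fun y hy => ?_
  have hUy : U ∈ 𝓝 y := hU.mem_nhds (hKU hy)
  have hcont : ContinuousAt f (x₀, y) := hf.continuousAt (prod_mem_nhds hI hUy)
  have hproj : ContinuousAt (fun p : X × Y => f (x₀, p.2)) (x₀, y) :=
    ContinuousAt.comp (g := f) (f := fun p : X × Y => (x₀, p.2)) hcont (by fun_prop)
  refine (hcont.sub hproj).norm.eventually_le_const ?_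
  simpa using he

namespace Wiener

variable {ρ : ℝ} [hρ : Fact (1 < ρ)]

theorem eval_sub (f g : Wiener ρ) {z : ℂ} (hz : z ∈ openAnnulus ρ) :
    (f - g).eval z = f.eval z - g.eval z :=
  map_sub (evalCLM hz) f g

theorem hasDerivAt_eval_of_sphere {φ : ℂ → Wiener ρ} {g : ℂ → ℂ} {w : ℂ}
    (hφ : DifferentiableAt ℝ φ w) (hg : DifferentiableOn ℂ g (openAnnulus ρ))
    (h : ∀ z ∈ sphere (0 : ℂ) 1, HasDerivAt (fun u => (φ u).eval z) (g z) w) {z : ℂ}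
    (hz : z ∈ openAnnulus ρ) :
    HasDerivAt (fun u => (φ u).eval z) (g z) w := by
  have hreal {z : ℂ} (hz : z ∈ openAnnulus ρ) : HasFDerivAt (fun u => (φ u).eval z)
      (((evalCLM hz).restrictScalars ℝ).comp (fderiv ℝ φ w)) w :=
    ((evalCLM hz).restrictScalars ℝ).hasFDerivAt.comp w hφ.hasFDerivAt
  have hsphere (v : ℂ) : EqOn (fderiv ℝ φ w v).eval (fun z => v * g z) (sphere 0 1) :=
    fun z hz => DFunLike.congr_fun ((hreal (sphere_subset_openAnnulus hρ.out hz)).unique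
      ((h z hz).hasFDerivAt.restrictScalars ℝ)) v
  refine (hasFDerivAt_of_restrictScalars ℝ (hreal hz) (ContinuousLinearMap.ext fun v => ?_))
  exact (eqOn_openAnnulus_of_eqOn_sphere hρ.out (differentiableOn_eval _)
    (hg.const_mul v) (hsphere v) hz).symm

end Wiener

namespace LoopMatrix

variable {ρ : ℝ}

theorem eval_apply (A : LoopMatrix ρ) (z : ℂ) (i j : Fin 2) : A.eval z i j = (A i j).eval z := rfl

variable [hρ : Fact (1 < ρ)]

theorem differentiableOn_eval (A : LoopMatrix ρ) : DifferentiableOn ℂ A.eval (openAnnulus ρ) :=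
  fun _ hz => (differentiableAt_matrix_iff.mpr fun i j =>
    (A i j).differentiableOn_eval.differentiableAt
      ((isOpen_openAnnulus ρ).mem_nhds hz)).differentiableWithinAt

theorem eval_sub (A B : LoopMatrix ρ) {z : ℂ} (hz : z ∈ openAnnulus ρ) :
    (A - B).eval z = A.eval z - B.eval z :=
  Matrix.ext fun i j => Wiener.eval_sub (A i j) (B i j) hz

theorem norm_eval_le_sum (A : LoopMatrix ρ) {z : ℂ} (hz : z ∈ openAnnulus ρ) :
    ‖A.eval z‖ ≤ ∑ i, ∑ j, ‖A i j‖ :=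
  (l2_opNorm_le_sum _).trans (Finset.sum_le_sum fun i _ => Finset.sum_le_sum fun j _ =>
    (A i j).norm_eval_le hz)

theorem norm_adjugate_eval_le_sum (A : LoopMatrix ρ) {z : ℂ} (hz : z ∈ openAnnulus ρ) :
    ‖(A.eval z).adjugate‖ ≤ ∑ i, ∑ j, ‖A i j‖ := by
  refine (l2_opNorm_le_sum _).trans ?_
  have h (i j : Fin 2) := (A i j).norm_eval_le hz
  simp only [Matrix.adjugate_fin_two, Fin.sum_univ_two, Matrix.of_apply, Matrix.cons_val',
    eval_apply, Matrix.cons_val_zero, Matrix.cons_val_one, Matrix.cons_val_fin_one, norm_neg]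
  linarith [h 0 0, h 0 1, h 1 0, h 1 1]

theorem eventually_forall_norm_eval_sub_le {A : ℝ → ℂ → LoopMatrix ρ} {I : Set ℝ} {U K : Set ℂ}
    {t₀ : ℝ} (hI : I ∈ 𝓝 t₀) (hU : IsOpen U)
    (hA : ∀ i j, ContinuousOn (fun p : ℝ × ℂ => A p.1 p.2 i j) (I ×ˢ U)) (hK : IsCompact K)
    (hKU : K ⊆ U) {e : ℝ} (he : 0 < e) :
    ∀ᶠ t in 𝓝 t₀, ∀ u ∈ K, ∀ z ∈ openAnnulus ρ, ‖(A t u).eval z - (A t₀ u).eval z‖ ≤ e := by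
  have hentry : ∀ᶠ t in 𝓝 t₀, ∀ i j, ∀ u ∈ K, ‖A t u i j - A t₀ u i j‖ ≤ e / 4 := by
    simp only [eventually_all]
    exact fun i j => eventually_forall_norm_sub_le hI hU (hA i j) hK hKU (by positivity)
  filter_upwards [hentry] with t ht u hu z hz
  rw [← eval_sub _ _ hz]
  refine (norm_eval_le_sum _ hz).trans ?_
  simp only [Fin.sum_univ_two, Matrix.sub_apply]
  linarith [ht 0 0 u hu, ht 0 1 u hu, ht 1 0 u hu, ht 1 1 u hu]

end LoopMatrix

theorem LoopSL.det_eval {ρ : ℝ} [hρ : Fact (1 < ρ)] {A : LoopMatrix ρ} (hA : A ∈ LoopSL ρ) {z : ℂ}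
    (hz : z ∈ openAnnulus ρ) : (A.eval z).det = 1 :=
  eqOn_openAnnulus_of_eqOn_sphere hρ.out
    (differentiable_det.comp_differentiableOn A.differentiableOn_eval) (differentiableOn_const 1)
    (fun z hz => hA z hz) hz

theorem LoopHolomorphicOn.differentiableOn_eval {ρ : ℝ} [Fact (1 < ρ)]
    {A : ℂ → LoopMatrix ρ} {U : Set ℂ} (hA : LoopHolomorphicOn A U) (hU : IsOpen U) {z : ℂ}
    (hz : z ∈ openAnnulus ρ) : DifferentiableOn ℂ (fun u => (A u).eval z) U :=
  fun u hu => (differentiableAt_matrix_iff.mpr fun i j =>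
    (Wiener.evalCLM hz).differentiableAt.comp u
      ((hA i j).differentiableAt (hU.mem_nhds hu))).differentiableWithinAt

theorem SolvesPotential.hasDerivAt {ρ : ℝ} [hρ : Fact (1 < ρ)] {A Φ : ℂ → LoopMatrix ρ} {r : ℝ}
    (h : SolvesPotential A Φ r) {w : ℂ} (hw : w ∈ coverOfPuncturedDisc r)
    (hΦ : ∀ i j, DifferentiableAt ℝ (fun u => Φ u i j) w) {z : ℂ} (hz : z ∈ openAnnulus ρ) :
    HasDerivAt (fun u => (Φ u).eval z)
      ((Φ w).eval z * (Complex.exp w • (A (Complex.exp w)).eval z)) w := by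
  have hg : DifferentiableOn ℂ
      (fun z => (Φ w).eval z * (Complex.exp w • (A (Complex.exp w)).eval z)) (openAnnulus ρ) :=
    (Φ w).differentiableOn_eval.fun_mul
      ((A (Complex.exp w)).differentiableOn_eval.fun_const_smul _)
  refine hasDerivAt_matrix_iff.mpr fun i j => Wiener.hasDerivAt_eval_of_sphere (hΦ i j)
    (g := fun z => ((Φ w).eval z * (Complex.exp w • (A (Complex.exp w)).eval z)) i j)
    (fun z hz => ?_) (fun z hz => h w hw z hz i j) hz
  exact (differentiableAt_matrix_iff.mp (hg.differentiableAt
    ((isOpen_openAnnulus ρ).mem_nhds hz)) i j).differentiableWithinAt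

/-- The potential `A dz` has polar part `λ⁻¹ (a z⁻²ᵐ⁻¹ + b z⁻ᵐ⁻¹ + c z⁻¹) dz` in the upper right
corner, with remainder `Ξ dz`. The identity is imposed on the unit circle only. -/
def HasPolarPart {ρ : ℝ} (m : ℕ) (r : ℝ) (a b c : Wiener ρ) (A Ξ : ℂ → LoopMatrix ρ) : Prop :=
  ∀ z ∈ puncturedDisc r, ∀ lam ∈ sphere (0 : ℂ) 1, (A z).eval lam =
    principalPart m (a.eval lam) (b.eval lam) (c.eval lam) z • !![0, lam⁻¹; 0, 0] + (Ξ z).eval lam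

theorem mul_principalPart_left (m : ℕ) (x α β γ z : ℂ) :
    x * principalPart m α β γ z = principalPart m (x * α) (x * β) (x * γ) z := by
  rw [principalPart, principalPart]
  ring

namespace HasPolarPart

variable {ρ : ℝ} [hρ : Fact (1 < ρ)] {m : ℕ} {r : ℝ} {a b c : Wiener ρ} {A Ξ : ℂ → LoopMatrix ρ}

theorem eval_eq (h : HasPolarPart m r a b c A Ξ) {u : ℂ} (hu : u ∈ puncturedDisc r) {z : ℂ}
    (hz : z ∈ openAnnulus ρ) :
    (A u).eval z = principalPart m (z⁻¹ * a.eval z) (z⁻¹ * b.eval z) (z⁻¹ * c.eval z) u •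
      Matrix.single 0 1 1 + (Ξ u).eval z := by
  have hinv : DifferentiableOn ℂ (fun z : ℂ => z⁻¹) (openAnnulus ρ) :=
    differentiableOn_inv.mono fun z hz => ne_zero_of_mem_openAnnulus hρ.out hz
  have hpp : DifferentiableOn ℂ (fun z => principalPart m (z⁻¹ * a.eval z) (z⁻¹ * b.eval z)
      (z⁻¹ * c.eval z) u) (openAnnulus ρ) :=
    (((hinv.fun_mul a.differentiableOn_eval).div_const _).fun_add
      ((hinv.fun_mul b.differentiableOn_eval).div_const _)).fun_add
      ((hinv.fun_mul c.differentiableOn_eval).div_const _)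
  refine eqOn_openAnnulus_of_eqOn_sphere hρ.out (A u).differentiableOn_eval
    ((hpp.smul_const _).fun_add (Ξ u).differentiableOn_eval) (fun z hz => ?_) hz
  beta_reduce
  rw [h u hu z hz, ← mul_principalPart_left]
  ext i j
  fin_cases i <;> fin_cases j <;> simp [Matrix.single, mul_comm]

theorem coeff_eq (h : HasPolarPart m r a b c A Ξ) {u : ℂ} (hu : u ∈ puncturedDisc r) (k : ℤ) :
    (A u 0 1).coeff (k - 1) =
      principalPart m (a.coeff k) (b.coeff k) (c.coeff k) u + (Ξ u 0 1).coeff (k - 1) := by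
  have hshift : ((u ^ (2 * m + 1))⁻¹ • a + (u ^ (m + 1))⁻¹ • b + u⁻¹ • c).coeff (k - 1 + 1) =
      (A u 0 1 - Ξ u 0 1).coeff (k - 1) := by
    refine Wiener.coeff_eq_of_eval_eq_zpow_mul_eval (fun z hz => ?_) _
    have hzA := sphere_subset_openAnnulus hρ.out hz
    have hz0 := ne_zero_of_mem_openAnnulus hρ.out hzA
    have hentry := congrFun (congrFun (h u hu z hz) 0) 1
    simp only [Matrix.add_apply, Matrix.smul_apply, LoopMatrix.eval_apply, Matrix.of_apply,
      Matrix.cons_val', Matrix.cons_val_zero, Matrix.cons_val_one, Matrix.cons_val_fin_one,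
      smul_eq_mul, principalPart] at hentry
    rw [Wiener.eval_sub _ _ hzA, hentry, add_sub_cancel_right, zpow_one, mul_left_comm,
      mul_inv_cancel₀ hz0, mul_one]
    change Wiener.evalCLM hzA _ = _
    simp only [map_add, map_smul, smul_eq_mul, ← div_eq_inv_mul]
    rfl
  have hsub : (A u 0 1 - Ξ u 0 1).coeff (k - 1) = (A u 0 1).coeff (k - 1) -
      (Ξ u 0 1).coeff (k - 1) := map_sub (Wiener.coeffCLM (k - 1)) _ _
  rw [hsub, sub_add_cancel, eq_sub_iff_add_eq] at hshift
  rw [← hshift, principalPart]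
  simp only [Wiener.coeff_add, Wiener.coeff_smul, div_eq_inv_mul]

theorem coeff_eq_zero (h : HasPolarPart m r a b c A Ξ) (hm : m ≠ 0) (hr : 0 < r)
    (hΞ : LoopHolomorphicOn Ξ (ball 0 r))
    (hA : ∀ u ∈ puncturedDisc r, ∀ k < -1, (A u).coeff k = 0) {k : ℤ} (hk : k < 0) :
    a.coeff k = 0 ∧ b.coeff k = 0 ∧ c.coeff k = 0 := by
  have hcoeff : DifferentiableOn ℂ (fun u => (Ξ u 0 1).coeff (k - 1)) (ball 0 r) :=
    (Wiener.coeffCLM (k - 1)).differentiable.comp_differentiableOn (hΞ 0 1)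
  simpa using norm_smul_le_of_norm_principalPart_smul_add_le (v := (1 : ℂ)) (e := 0) hm
    (half_pos hr) (half_lt_self hr) hcoeff fun u hu => by
      have hu' := sphere_subset_puncturedDisc (half_pos hr) (half_lt_self hr) hu
      have hzero : (A u 0 1).coeff (k - 1) = 0 :=
        congrFun (congrFun (hA u hu' (k - 1) (by lia)) 0) 1
      rw [smul_eq_mul, mul_one, ← h.coeff_eq hu' k, hzero, norm_zero]

theorem eq_of_eq_zero (h : HasPolarPart m r 0 0 0 A Ξ) {u : ℂ} (hu : u ∈ puncturedDisc r) :
    A u = Ξ u := by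
  ext i j : 2
  refine Wiener.ext_eval_sphere fun z hz => ?_
  have heval := congrFun (congrFun (h u hu z hz) i) j
  simpa [LoopMatrix.eval_apply, Wiener.eval_zero_loop, principalPart] using heval

end HasPolarPart

/-! ### Monodromy of the family -/

section TraceFreePart

variable {A B M : Matrix (Fin 2) (Fin 2) ℂ}

/-- The projection of `2 × 2` matrices onto the trace-free ones along the scalars. -/
noncomputable def traceFreePart : Matrix (Fin 2) (Fin 2) ℂ →L[ℂ] Matrix (Fin 2) (Fin 2) ℂ :=
  LinearMap.toContinuousLinearMap
    (LinearMap.id - (Matrix.traceLinearMap (Fin 2) ℂ ℂ).smulRight ((2 : ℂ)⁻¹ • 1))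

theorem traceFreePart_apply (A : Matrix (Fin 2) (Fin 2) ℂ) :
    traceFreePart A = A - (A.trace / 2) • 1 := by
  simp [traceFreePart, smul_smul, div_eq_mul_inv]

theorem trace_traceFreePart (A : Matrix (Fin 2) (Fin 2) ℂ) : (traceFreePart A).trace = 0 := by
  simp [traceFreePart_apply]

theorem traceFreePart_one : traceFreePart 1 = 0 := by
  simp [traceFreePart_apply]

theorem traceFreePart_eq_self (hB : B.trace = 0) : traceFreePart B = B := by
  simp [traceFreePart_apply, hB]

theorem norm_traceFreePart_le (A : Matrix (Fin 2) (Fin 2) ℂ) : ‖traceFreePart A‖ ≤ 2 * ‖A‖ := by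
  have htrace : ‖A.trace‖ ≤ 2 * ‖A‖ := by
    rw [Matrix.trace_fin_two]
    linarith [norm_add_le (A 0 0) (A 1 1), norm_apply_le_l2_opNorm A 0 0,
      norm_apply_le_l2_opNorm A 1 1]
  rw [traceFreePart_apply]
  refine (norm_sub_le _ _).trans ?_
  rw [norm_smul, norm_one, mul_one, norm_div, Complex.norm_ofNat]
  linarith

theorem conjTranspose_traceFreePart (hM : M ∈ Matrix.specialUnitaryGroup (Fin 2) ℂ) :
    (traceFreePart M).conjTranspose = -traceFreePart M := by
  obtain ⟨hunitary, hdet⟩ := Matrix.mem_specialUnitaryGroup_iff.mp hM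
  have hadj : M.conjTranspose = M.adjugate :=
    left_inv_eq_right_inv (Matrix.mem_unitaryGroup_iff'.mp hunitary)
      (by rw [M.mul_adjugate, hdet, one_smul])
  have htrace : star M.trace = M.trace := by
    rw [← Matrix.trace_conjTranspose, hadj, Matrix.adjugate_fin_two]
    simp [Matrix.trace_fin_two, add_comm]
  rw [traceFreePart_apply, Matrix.conjTranspose_sub, Matrix.conjTranspose_smul, hadj, star_div₀,
    htrace, Matrix.conjTranspose_one, Matrix.adjugate_fin_two]
  ext i j
  fin_cases i <;> fin_cases j <;> simp [Matrix.trace_fin_two] <;> ring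

theorem IsNearConj.traceFreePart {κ ε : ℝ} (h : IsNearConj κ ε (M - 1) B) (hB : B.trace = 0) :
    IsNearConj κ (2 * ε) (traceFreePart M) B := by
  obtain ⟨C, C', hCC', hC, hC', hε⟩ := h
  have htrace : (C * B * C').trace = 0 := by
    rw [Matrix.trace_mul_comm, ← mul_assoc, mul_eq_one_comm.mp hCC', one_mul, hB]
  refine ⟨C, C', hCC', hC, hC', ?_⟩
  have hsub := norm_traceFreePart_le (M - 1 - C * B * C')
  rw [map_sub, map_sub, traceFreePart_one, sub_zero, traceFreePart_eq_self htrace] at hsub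
  linarith

end TraceFreePart

section Monodromy

variable {ρ : ℝ} [hρ : Fact (1 < ρ)] {Φ : ℂ → LoopMatrix ρ} {w₀ : ℂ}

theorem monodromy_mul_eval (hΦ : Φ w₀ ∈ LoopSL ρ) {z : ℂ} (hz : z ∈ openAnnulus ρ) :
    monodromy Φ w₀ z * (Φ w₀).eval z = (Φ (w₀ + 2 * Real.pi * I)).eval z :=
  Matrix.nonsing_inv_mul_cancel_right _ _ (by rw [LoopSL.det_eval hΦ hz]; exact isUnit_one)

theorem differentiableOn_monodromy (hΦ : Φ w₀ ∈ LoopSL ρ) :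
    DifferentiableOn ℂ (monodromy Φ w₀) (openAnnulus ρ) := by
  have hunit (z : ℂ) (hz : z ∈ openAnnulus ρ) : IsUnit ((Φ w₀).eval z) := by
    rw [Matrix.isUnit_iff_isUnit_det, LoopSL.det_eval hΦ hz]
    exact isUnit_one
  unfold monodromy
  simp only [Matrix.nonsing_inv_eq_ringInverse]
  exact (LoopMatrix.differentiableOn_eval _).fun_mul
    ((LoopMatrix.differentiableOn_eval _).inverse hunit)

theorem MonodromyProblem.hasDerivAt_traceFreePart {M : ℂ → Matrix (Fin 2) (Fin 2) ℂ} {l₁ l₂ : ℂ}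
    (h : MonodromyProblem M l₁ l₂) (hl : l₂ = l₁) :
    HasDerivAt (fun z => traceFreePart (M z)) 0 l₁ := by
  have hM : HasDerivAt M 0 l₁ := hasDerivAt_matrix_iff.mpr (h.2.2.2 hl)
  have hcomp := traceFreePart.hasFDerivAt.comp_hasDerivAt l₁ hM
  rwa [map_zero] at hcomp

end Monodromy

section ResidueMatrix

variable {α β γ : ℂ}

/-- The matrix to which the monodromy minus the identity is nearly conjugate, up to the factor
`λ⁻¹`, when the polar part of the potential has the coefficients `α`, `β`, `γ`. -/
noncomputable def residueMatrix (α β γ : ℂ) : Matrix (Fin 2) (Fin 2) ℂ :=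
  (2 * Real.pi * I) • !![-β, γ; -α, β]

theorem two_pi_I_smul_gaugedResidue_single (α β γ : ℂ) :
    (2 * Real.pi * I : ℂ) • gaugedResidue (Matrix.single 0 1 1) (Matrix.single 1 0 1) α β γ =
      residueMatrix α β γ := by
  rw [residueMatrix, gaugedResidue]
  ext i j
  fin_cases i <;> fin_cases j <;> simp [Matrix.single, Matrix.mul_apply]

theorem residueMatrix_mul (x α β γ : ℂ) :
    residueMatrix (x * α) (x * β) (x * γ) = x • residueMatrix α β γ := by
  rw [residueMatrix, residueMatrix, smul_comm]
  simp

theorem trace_residueMatrix (α β γ : ℂ) : (residueMatrix α β γ).trace = 0 := by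
  simp [residueMatrix, Matrix.trace_fin_two]

theorem det_residueMatrix (α β γ : ℂ) :
    (residueMatrix α β γ).det = -(2 * Real.pi) ^ 2 * (α * γ - β ^ 2) := by
  simp only [residueMatrix, Matrix.det_smul, Matrix.det_fin_two_of, Fintype.card_fin, mul_pow, I_sq]
  ring

theorem norm_add_norm_add_norm_le_norm_residueMatrix (α β γ : ℂ) :
    ‖α‖ + ‖β‖ + ‖γ‖ ≤ ‖residueMatrix α β γ‖ := by
  have hentry (i j : Fin 2) := norm_apply_le_l2_opNorm !![-β, γ; -α, β] i j
  have hα : ‖α‖ ≤ ‖!![-β, γ; -α, β]‖ := by simpa using hentry 1 0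
  have hβ : ‖β‖ ≤ ‖!![-β, γ; -α, β]‖ := by simpa using hentry 1 1
  have hγ : ‖γ‖ ≤ ‖!![-β, γ; -α, β]‖ := by simpa using hentry 0 1
  have hpi : ‖(2 * Real.pi * I : ℂ)‖ = 2 * Real.pi := by simp [abs_of_pos Real.pi_pos]
  rw [residueMatrix, norm_smul, hpi]
  nlinarith [Real.pi_gt_three, norm_nonneg !![-β, γ; -α, β]]

theorem eq_zero_of_residueMatrix_eq_zero (h : residueMatrix α β γ = 0) :
    α = 0 ∧ β = 0 ∧ γ = 0 := by
  have hsum := norm_add_norm_add_norm_le_norm_residueMatrix α β γ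
  rw [h, norm_zero] at hsum
  refine ⟨norm_le_zero_iff.mp ?_, norm_le_zero_iff.mp ?_, norm_le_zero_iff.mp ?_⟩ <;>
    linarith [norm_nonneg α, norm_nonneg β, norm_nonneg γ]

theorem differentiableOn_residueMatrix {α β γ : ℂ → ℂ} {S : Set ℂ} (hα : DifferentiableOn ℂ α S)
    (hβ : DifferentiableOn ℂ β S) (hγ : DifferentiableOn ℂ γ S) :
    DifferentiableOn ℂ (fun z => residueMatrix (α z) (β z) (γ z)) S := by
  simp only [← two_pi_I_smul_gaugedResidue_single, gaugedResidue]
  exact (((hγ.smul_const _).fun_add (hβ.smul_const _)).fun_sub (hα.smul_const _)).fun_const_smul _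

end ResidueMatrix

section Frame

theorem mul_one_sub_smul_eq_of_hasDerivAt {𝔸 : Type*} [NormedRing 𝔸] [NormedAlgebra ℂ 𝔸] {F : 𝔸}
    (hF : F * F = 0) {U : ℂ → 𝔸} {m : ℕ} {w₀ w₁ : ℂ}
    (hU : ∀ w ∈ segment ℝ w₀ w₁,
      HasDerivAt U (U w * (Complex.exp w • ((m : ℂ) * Complex.exp w ^ (m - 1)) • F)) w)
    {w : ℂ} (hw : w ∈ segment ℝ w₀ w₁) :
    U w * (1 - Complex.exp w ^ m • F) = U w₀ * (1 - Complex.exp w₀ ^ m • F) := by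
  have hderiv (v : ℂ) (hv : v ∈ segment ℝ w₀ w₁) :
      HasDerivAt (fun w => U w * (1 - Complex.exp w ^ m • F) * 1) 0 v := by
    simpa using hasDerivAt_gauged_mul (m := m) hF (E := 0) (f := 0) (Ψ := fun _ => 1)
      (Ξ := fun z => ((m : ℂ) * z ^ (m - 1)) • F) (by simpa using hU v hv)
      (by simpa using hasDerivAt_const (Complex.exp v) (1 : 𝔸))
  have hle := (convex_segment w₀ w₁).norm_image_sub_le_of_norm_hasDerivWithin_le (C := 0)
    (fun v hv => (hderiv v hv).hasDerivWithinAt) (fun _ _ => by simp) (left_mem_segment ℝ w₀ w₁) hw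
  simpa [sub_eq_zero] using hle

theorem exists_isNearConj_gaugedResidue {𝔸 : Type*} [NormedRing 𝔸] [NormedAlgebra ℂ 𝔸]
    [NormOneClass 𝔸] [CompleteSpace 𝔸] {m : ℕ} (hm : m ≠ 0) {w₀ : ℂ} {r R η : ℝ}
    (hw₀R : ‖Complex.exp w₀‖ < R) (hRr : R < r) (κ : ℝ) (E : 𝔸) {F : 𝔸} (hF : F * F = 0)
    (hη : 0 < η) :
    ∃ ε > 0, ∀ (C C' D : 𝔸) (U Ξ : ℂ → 𝔸) (α β γ : ℂ), C * C' = 1 → ‖C‖ ≤ κ → ‖C'‖ ≤ κ →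
      DifferentiableOn ℂ Ξ (ball 0 r) →
      (∀ w ∈ segment ℝ w₀ (w₀ + 2 * Real.pi * I), HasDerivAt U (U w * (Complex.exp w •
        (principalPart m α β γ (Complex.exp w) • E + Ξ (Complex.exp w)))) w) →
      (∀ z ∈ sphere (0 : ℂ) R,
        ‖principalPart m α β γ z • E + Ξ z - ((m : ℂ) * z ^ (m - 1)) • F‖ ≤ ε) →
      (∀ w ∈ segment ℝ w₀ (w₀ + 2 * Real.pi * I),
        ‖U w * (1 - Complex.exp w ^ m • F) - C‖ ≤ ε) →
      (1 + D) * U w₀ = U (w₀ + 2 * Real.pi * I) →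
      IsNearConj κ (η * (‖α‖ + ‖β‖ + ‖γ‖)) D ((2 * Real.pi * I) • gaugedResidue E F α β γ) := by
  have hR : 0 < R := (norm_nonneg _).trans_lt hw₀R
  set L := 2 * ((1 + R ^ m * ‖F‖) ^ 2 * R) + 1 with hL
  set p := (‖Complex.exp w₀‖⁻¹ ^ (2 * m) + ‖Complex.exp w₀‖⁻¹ ^ m + 1) *
    ((1 + R ^ m * ‖F‖) ^ 2 * ‖E‖) with hp
  have hsmall (b : ℝ) {c : ℝ} (hc : 0 < c) : ∀ᶠ ε in 𝓝[>] (0 : ℝ), b * ε ≤ c := by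
    have hcont : ContinuousAt (fun ε => b * ε) 0 := by fun_prop
    refine (hcont.eventually_le_const ?_).filter_mono nhdsWithin_le_nhds
    rwa [← mul_zero b] at hc
  obtain ⟨ε, hε₁, hε₂, hε₃, hε : 0 < ε⟩ := ((hsmall L one_pos).and
    ((hsmall (κ * ((2 + κ) * L)) one_half_pos).and
      ((hsmall (2 * κ * (1 + κ ^ 2) * ((2 + κ) * L) * (p * (2 * Real.pi))) hη).and
        self_mem_nhdsWithin))).exists
  refine ⟨ε / 4, by positivity, fun C C' D U Ξ α β γ hCC' hC hC' hΞ hU hA hUC hD => ?_⟩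
  have hΞε (z : ℂ) (hz : z ∈ sphere 0 R) : ‖Ξ z - ((m : ℂ) * z ^ (m - 1)) • F‖ ≤ ε := by
    linarith [norm_le_of_norm_principalPart_smul_add_le (e := ε / 4)
      (h := fun z => Ξ z - ((m : ℂ) * z ^ (m - 1)) • F) hm hR hRr (hΞ.fun_sub (by fun_prop))
      (fun z hz => by rw [← add_sub_assoc]; exact hA z hz) hz]
  refine (isNearConj_gaugedResidue (δ := L * ε) hm hw₀R hRr hF hCC' hC hC' hΞ hU hΞε
    (fun w hw => (hUC w hw).trans ?_) hD (by linarith [hL]) hε₁ (by linarith)).mono ?_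
  · have hL₁ : ε ≤ L * ε := le_mul_of_one_le_left hε.le (le_add_of_nonneg_left (by positivity))
    linarith
  · rw [← hp]
    calc _ = 2 * κ * (1 + κ ^ 2) * ((2 + κ) * L) * (p * (2 * Real.pi)) * ε *
          (‖α‖ + ‖β‖ + ‖γ‖) := by ring
      _ ≤ η * (‖α‖ + ‖β‖ + ‖γ‖) := by gcongr

variable {ρ : ℝ} [hρ : Fact (1 < ρ)] {m : ℕ} {r : ℝ} {w₀ : ℂ}

theorem LoopSL.exists_forall_mul_eq_one {A : LoopMatrix ρ} (hA : A ∈ LoopSL ρ)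
    {P P' : Matrix (Fin 2) (Fin 2) ℂ} (hP : P * P' = 1) :
    ∃ κ : ℝ, ∀ z ∈ openAnnulus ρ, ∃ C',
      A.eval z * P * C' = 1 ∧ ‖A.eval z * P‖ ≤ κ ∧ ‖C'‖ ≤ κ := by
  set S := ∑ i, ∑ j, ‖A i j‖
  refine ⟨S * (‖P‖ + ‖P'‖), fun z hz => ⟨P' * (A.eval z).adjugate, ?_, ?_, ?_⟩⟩
  · rw [mul_assoc, ← mul_assoc P, hP, one_mul, Matrix.mul_adjugate, LoopSL.det_eval hA hz, one_smul]
  · calc ‖A.eval z * P‖ ≤ ‖A.eval z‖ * ‖P‖ := norm_mul_le _ _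
      _ ≤ S * (‖P‖ + ‖P'‖) := by
        gcongr
        exacts [A.norm_eval_le_sum hz, le_add_of_nonneg_right (norm_nonneg _)]
  · calc ‖P' * (A.eval z).adjugate‖ ≤ ‖P'‖ * ‖(A.eval z).adjugate‖ := norm_mul_le _ _
      _ ≤ (‖P‖ + ‖P'‖) * S := by
        gcongr
        exacts [le_add_of_nonneg_left (norm_nonneg _), A.norm_adjugate_eval_le_sum hz]
      _ = S * (‖P‖ + ‖P'‖) := mul_comm _ _

theorem LoopMatrix.eval_eq_smul_single {A : LoopMatrix ρ} {x : ℂ}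
    (hA : ∀ z ∈ sphere (0 : ℂ) 1, A.eval z = !![0, 0; x, 0]) {z : ℂ} (hz : z ∈ openAnnulus ρ) :
    A.eval z = x • Matrix.single 1 0 1 := by
  refine eqOn_openAnnulus_of_eqOn_sphere hρ.out A.differentiableOn_eval
    (differentiableOn_const _) (fun z hz => ?_) hz
  rw [hA z hz]
  ext i j
  fin_cases i <;> fin_cases j <;> simp [Matrix.single]

theorem LoopC1On.differentiableAt {A : ℝ → ℂ → LoopMatrix ρ} {I : Set ℝ} {U : Set ℂ}
    (hA : LoopC1On A I U) (hU : IsOpen U) {t : ℝ} (ht : t ∈ I) {w : ℂ} (hw : w ∈ U) (i j : Fin 2) :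
    DifferentiableAt ℝ (fun u => A t u i j) w := by
  have hcomp := ((hA i j).differentiableOn one_ne_zero).comp (f := fun u : ℂ => (t, u)) (s := U)
    (by fun_prop) (fun u hu => ⟨ht, hu⟩)
  exact hcomp.differentiableAt (hU.mem_nhds hw)

end Frame

section Estimate

variable {ρ : ℝ} [Fact (1 < ρ)] {m : ℕ} {r : ℝ} {w₀ : ℂ} {I₀ : Set ℝ}
  {η Φ Ξ : ℝ → ℂ → LoopMatrix ρ} {a b c : ℝ → Wiener ρ}

theorem mul_one_sub_smul_single_eq {A Φ : ℂ → LoopMatrix ρ} (hΦ : SolvesPotential A Φ r)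
    (hΦd : ∀ w ∈ coverOfPuncturedDisc r, ∀ i j, DifferentiableAt ℝ (fun u => Φ u i j) w)
    (hA : ∀ z ∈ puncturedDisc r, ∀ lam ∈ sphere (0 : ℂ) 1,
      (A z).eval lam = !![0, 0; (m : ℂ) * z ^ (m - 1), 0])
    (hw₀ : w₀ ∈ coverOfPuncturedDisc r) {w : ℂ} (hw : w ∈ segment ℝ w₀ (w₀ + 2 * Real.pi * I))
    {z : ℂ} (hz : z ∈ openAnnulus ρ) :
    (Φ w).eval z * (1 - Complex.exp w ^ m • Matrix.single 1 0 1) =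
      (Φ w₀).eval z * (1 - Complex.exp w₀ ^ m • Matrix.single 1 0 1) := by
  refine mul_one_sub_smul_eq_of_hasDerivAt (U := fun w => (Φ w).eval z) (by simp)
    (fun v hv => ?_) hw
  have hv' := segment_subset_coverOfPuncturedDisc hw₀ hv
  rw [← LoopMatrix.eval_eq_smul_single (hA _ hv') hz]
  exact hΦ.hasDerivAt hv' (hΦd v hv') hz

theorem eventually_forall_norm_frame_sub_le (hI : I₀ ∈ 𝓝 0)
    (hΦC1 : LoopC1On Φ I₀ (coverOfPuncturedDisc r)) (hΦ : SolvesPotential (η 0) (Φ 0) r)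
    (hη0 : ∀ z ∈ puncturedDisc r, ∀ lam ∈ sphere (0 : ℂ) 1,
      (η 0 z).eval lam = !![0, 0; (m : ℂ) * z ^ (m - 1), 0])
    (hw₀ : w₀ ∈ coverOfPuncturedDisc r) {ε : ℝ} (hε : 0 < ε) :
    ∀ᶠ t in 𝓝 0, ∀ w ∈ segment ℝ w₀ (w₀ + 2 * Real.pi * I), ∀ z ∈ openAnnulus ρ,
      ‖(Φ t w).eval z * (1 - Complex.exp w ^ m • Matrix.single 1 0 1) -
        (Φ 0 w₀).eval z * (1 - Complex.exp w₀ ^ m • Matrix.single 1 0 1)‖ ≤ ε := by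
  set L := 1 + ‖Complex.exp w₀‖ ^ m
  have hL : 0 < L := by positivity
  have hG (w : ℂ) (hw : w ∈ segment ℝ w₀ (w₀ + 2 * Real.pi * I)) :
      ‖(1 - Complex.exp w ^ m • Matrix.single 1 0 1 : Matrix (Fin 2) (Fin 2) ℂ)‖ ≤ L := by
    refine (norm_sub_le _ _).trans_eq ?_
    rw [norm_one, norm_smul, l2_opNorm_single, norm_one, mul_one, norm_pow,
      norm_exp_of_mem_segment hw]
  have hcompact : IsCompact (segment ℝ w₀ (w₀ + 2 * Real.pi * I)) := by
    rw [segment_eq_image ℝ]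
    exact isCompact_Icc.image (by fun_prop)
  filter_upwards [LoopMatrix.eventually_forall_norm_eval_sub_le hI (isOpen_coverOfPuncturedDisc r)
    (fun i j => (hΦC1 i j).continuousOn) hcompact (segment_subset_coverOfPuncturedDisc hw₀)
    (div_pos hε hL)] with t ht w hw z hz
  have hΦd (v : ℂ) (hv : v ∈ coverOfPuncturedDisc r) :=
    hΦC1.differentiableAt (isOpen_coverOfPuncturedDisc r) (mem_of_mem_nhds hI) hv
  rw [← mul_one_sub_smul_single_eq hΦ hΦd hη0 hw₀ hw hz, ← sub_mul]
  calc _ ≤ ε / L * L := norm_mul_le_of_le (ht w hw z hz) (hG w hw)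
    _ = ε := div_mul_cancel₀ ε hL.ne'

theorem eventually_isNearConj_residueMatrix (hI : I₀ ∈ 𝓝 0) (hm : m ≠ 0)
    (hηC : ∀ i j, ContinuousOn (fun p : ℝ × ℂ => η p.1 p.2 i j) (I₀ ×ˢ puncturedDisc r))
    (hη0 : ∀ z ∈ puncturedDisc r, ∀ lam ∈ sphere (0 : ℂ) 1,
      (η 0 z).eval lam = !![0, 0; (m : ℂ) * z ^ (m - 1), 0])
    (hpolar : ∀ t ∈ I₀, HasPolarPart m r (a t) (b t) (c t) (η t) (Ξ t))
    (hΞ : ∀ t ∈ I₀, LoopHolomorphicOn (Ξ t) (ball 0 r))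
    (hΦ : ∀ t ∈ I₀, SolvesPotential (η t) (Φ t) r)
    (hΦC1 : LoopC1On Φ I₀ (coverOfPuncturedDisc r))
    (hw₀ : w₀ ∈ coverOfPuncturedDisc r) (hΦSL : ∀ t ∈ I₀, Φ t w₀ ∈ LoopSL ρ) :
    ∃ κ : ℝ, ∀ e > 0, ∀ᶠ t in 𝓝 0, ∀ z ∈ openAnnulus ρ,
      IsNearConj κ
        (e * ‖residueMatrix (z⁻¹ * (a t).eval z) (z⁻¹ * (b t).eval z) (z⁻¹ * (c t).eval z)‖)
        (monodromy (Φ t) w₀ z - 1)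
        (residueMatrix (z⁻¹ * (a t).eval z) (z⁻¹ * (b t).eval z) (z⁻¹ * (c t).eval z)) := by
  have h0 : (0 : ℝ) ∈ I₀ := mem_of_mem_nhds hI
  have hF : (Matrix.single 1 0 1 * Matrix.single 1 0 1 : Matrix (Fin 2) (Fin 2) ℂ) = 0 := by simp
  obtain ⟨κ, hκ⟩ := LoopSL.exists_forall_mul_eq_one (hΦSL 0 h0)
    (one_sub_smul_mul_one_add_smul hF (Complex.exp w₀ ^ m))
  obtain ⟨R, hw₀R, hRr⟩ := exists_between (mem_coverOfPuncturedDisc.mp hw₀)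
  have hsphere := sphere_subset_puncturedDisc ((norm_nonneg _).trans_lt hw₀R) hRr
  refine ⟨κ, fun e he => ?_⟩
  obtain ⟨ε, hε, hnear⟩ :=
    exists_isNearConj_gaugedResidue hm hw₀R hRr κ (Matrix.single 0 1 1) hF he
  filter_upwards [hI, eventually_forall_norm_frame_sub_le hI hΦC1 (hΦ 0 h0) hη0 hw₀ hε,
    LoopMatrix.eventually_forall_norm_eval_sub_le hI (isOpen_puncturedDisc r) hηC
      (isCompact_sphere 0 R) hsphere hε] with t ht hframe hη z hz
  obtain ⟨C', hCC', hC, hC'⟩ := hκ z hz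
  rw [← two_pi_I_smul_gaugedResidue_single]
  refine (hnear _ C' _ (fun w => (Φ t w).eval z) (fun u => (Ξ t u).eval z) _ _ _ hCC' hC hC'
    ((hΞ t ht).differentiableOn_eval isOpen_ball hz) (fun w hw => ?_) (fun u hu => ?_)
    (fun w hw => hframe w hw z hz) ?_).mono ?_
  · have hw' := segment_subset_coverOfPuncturedDisc hw₀ hw
    rw [← (hpolar t ht).eval_eq hw' hz]
    exact (hΦ t ht).hasDerivAt hw'
      (hΦC1.differentiableAt (isOpen_coverOfPuncturedDisc r) ht hw') hz
  · rw [← (hpolar t ht).eval_eq (hsphere hu) hz,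
      ← LoopMatrix.eval_eq_smul_single (hη0 u (hsphere hu)) hz]
    exact hη u hu z hz
  · rw [add_sub_cancel, monodromy_mul_eval (hΦSL t ht) hz]
  · rw [two_pi_I_smul_gaugedResidue_single]
    gcongr
    exact norm_add_norm_add_norm_le_norm_residueMatrix _ _ _

end Estimate

section Vanishing

theorem IsNearConj.traceFreePart_residueMatrix {M : Matrix (Fin 2) (Fin 2) ℂ} {κ e s : ℝ}
    {z α β γ : ℂ} (he : 0 ≤ e) (hs : 0 < s) (hz : s⁻¹ ≤ ‖z‖)
    (h : IsNearConj κ (e / (2 * s) * ‖residueMatrix (z⁻¹ * α) (z⁻¹ * β) (z⁻¹ * γ)‖) (M - 1)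
      (residueMatrix (z⁻¹ * α) (z⁻¹ * β) (z⁻¹ * γ))) :
    IsNearConj κ (e * ‖residueMatrix α β γ‖) (_root_.traceFreePart M)
      (z⁻¹ • residueMatrix α β γ) := by
  have hnorm : ‖z⁻¹‖ ≤ s := by
    rw [norm_inv]
    exact inv_le_of_inv_le₀ hs hz
  have htrace := h.traceFreePart (trace_residueMatrix _ _ _)
  rw [residueMatrix_mul, norm_smul] at htrace
  refine htrace.mono ?_
  calc 2 * (e / (2 * s) * (‖z⁻¹‖ * ‖residueMatrix α β γ‖))
      ≤ 2 * (e / (2 * s) * (s * ‖residueMatrix α β γ‖)) := by gcongr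
    _ = e * ‖residueMatrix α β γ‖ := by field_simp

theorem exists_forall_eq_zero_of_monodromyProblem {ρ : ℝ} [hρ : Fact (1 < ρ)] {θ : ℝ} {l₁ l₂ : ℂ}
    (hl₁ : ‖l₁‖ < ρ) (hl₂ : ‖l₂‖ < ρ) (hsum : ∃ x : ℝ, l₁ + l₂ = Complex.exp (θ * I) * x)
    (hprod : l₁ * l₂ = Complex.exp (2 * θ * I)) (κ : ℝ) :
    ∃ e > 0, ∀ (M : ℂ → Matrix (Fin 2) (Fin 2) ℂ) (a b c : Wiener ρ),
      DifferentiableOn ℂ M (openAnnulus ρ) → MonodromyProblem M l₁ l₂ →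
      (∀ k < 0, a.coeff k = 0 ∧ b.coeff k = 0 ∧ c.coeff k = 0) →
      0 ≤ (Complex.exp (-2 * θ * I) * (a.coeff 0 * c.coeff 0 - b.coeff 0 ^ 2)).re →
      (∀ z ∈ openAnnulus ρ, IsNearConj κ
        (e * ‖residueMatrix (z⁻¹ * a.eval z) (z⁻¹ * b.eval z) (z⁻¹ * c.eval z)‖) (M z - 1)
        (residueMatrix (z⁻¹ * a.eval z) (z⁻¹ * b.eval z) (z⁻¹ * c.eval z))) →
      a = 0 ∧ b = 0 ∧ c = 0 := by
  obtain ⟨s, hmax, hsρ⟩ := exists_between (max_lt hρ.out (max_lt hl₁ hl₂))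
  obtain ⟨hs, hls⟩ := max_lt_iff.mp hmax
  obtain ⟨h₁, h₂⟩ := max_lt_iff.mp hls
  obtain ⟨e, he, hrigid⟩ := exists_forall_eqOn_zero_of_isNearConj hs hsρ h₁ h₂ hsum hprod κ
  have hs0 : 0 < s := one_pos.trans hs
  refine ⟨e / (2 * s), by positivity, fun M a b c hM hmon hcoeff hdet hnear => ?_⟩
  have hball {f : Wiener ρ} (hf : ∀ k < 0, f.coeff k = 0) :
      DifferentiableOn ℂ f.eval (closedBall 0 s) :=
    (f.differentiableOn_eval_ball hf).mono (closedBall_subset_ball hsρ)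
  have hzero := hrigid (fun z => traceFreePart (M z))
    (fun z => residueMatrix (a.eval z) (b.eval z) (c.eval z))
    (traceFreePart.differentiable.comp_differentiableOn hM)
    (fun z hz => conjTranspose_traceFreePart (hmon.1 z hz)) (fun z _ => trace_traceFreePart _)
    (by rw [hmon.2.1, traceFreePart_one]) (fun hl => by rw [hmon.2.2.1 hl, traceFreePart_one])
    hmon.hasDerivAt_traceFreePart
    (differentiableOn_residueMatrix (hball fun k hk => (hcoeff k hk).1)
      (hball fun k hk => (hcoeff k hk).2.1) (hball fun k hk => (hcoeff k hk).2.2)) ?_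
    (fun z hz₁ hz₂ => (hnear z (mem_openAnnulus_of_le hs hsρ hz₁ hz₂)).traceFreePart_residueMatrix
      he.le hs0 hz₁)
  · have hsphere (z : ℂ) (hz : z ∈ sphere (0 : ℂ) 1) := eq_zero_of_residueMatrix_eq_zero
      (hzero (sphere_subset_closedBall.trans (closedBall_subset_closedBall hs.le) hz))
    refine ⟨Wiener.ext_eval_sphere fun z hz => ?_, Wiener.ext_eval_sphere fun z hz => ?_,
      Wiener.ext_eval_sphere fun z hz => ?_⟩ <;> rw [Wiener.eval_zero_loop]
    exacts [(hsphere z hz).1, (hsphere z hz).2.1, (hsphere z hz).2.2]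
  · rw [Wiener.eval_zero, Wiener.eval_zero, Wiener.eval_zero, det_residueMatrix, mul_left_comm]
    have hcast : (-(2 * Real.pi) ^ 2 : ℂ) = ((-(2 * Real.pi) ^ 2 : ℝ) : ℂ) := by push_cast; rfl
    rw [hcast, Complex.re_ofReal_mul]
    exact mul_nonpos_of_nonpos_of_nonneg (neg_nonpos.mpr (sq_nonneg _)) hdet

end Vanishing

theorem re_exp_mul_neg_sq_nonneg {θ : ℝ} {β : ℂ} (hβ : (Complex.exp (-θ * I) * β).re = 0) :
    0 ≤ (Complex.exp (-2 * θ * I) * -β ^ 2).re := by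
  have hsq : Complex.exp (-2 * θ * I) * -β ^ 2 = -(Complex.exp (-θ * I) * β) ^ 2 := by
    rw [mul_pow, ← Complex.exp_nat_mul, mul_neg]
    congr 3
    push_cast
    ring
  rw [hsq, neg_re, sq, mul_re, hβ, zero_mul, zero_sub, neg_neg]
  exact mul_self_nonneg _

end

theorem mainTheorem7_general (ρ : ℝ) [Fact (1 < ρ)]
    (θ : ℝ) (l₁ l₂ : ℂ) (hl₁ : ‖l₁‖ < ρ) (hl₂ : ‖l₂‖ < ρ)
    (hsum : ∃ s : ℝ, l₁ + l₂ = Complex.exp (θ * Complex.I) * s)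
    (hprod : l₁ * l₂ = Complex.exp (2 * θ * Complex.I))
    (m : ℕ) (hm : 1 ≤ m) (r ε : ℝ) (hε : 0 < ε)
    (η Φ : ℝ → ℂ → LoopMatrix ρ)
    (hη : ∀ t ∈ Set.Ioo (-ε) ε, ∀ z ∈ puncturedDisc r, ∀ k < -1, (η t z).coeff k = 0)
    (hηC : ∀ i j, ContinuousOn (fun p : ℝ × ℂ => η p.1 p.2 i j) (Set.Ioo (-ε) ε ×ˢ puncturedDisc r))
    (hΦ : ∀ t ∈ Set.Ioo (-ε) ε, SolvesPotential (η t) (Φ t) r)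
    (hΦC1 : LoopC1On Φ (Set.Ioo (-ε) ε) (coverOfPuncturedDisc r))
    (a b c : ℝ → Wiener ρ) (Ξ : ℝ → ℂ → LoopMatrix ρ)
    (hΞ : ∀ t ∈ Set.Ioo (-ε) ε, LoopHolomorphicOn (Ξ t) (Metric.ball 0 r))
    (hpolar : ∀ t ∈ Set.Ioo (-ε) ε, HasPolarPart m r (a t) (b t) (c t) (η t) (Ξ t))
    (hη0 : ∀ z ∈ puncturedDisc r, ∀ lam ∈ Metric.sphere (0 : ℂ) 1,
      (η 0 z).eval lam = !![0, 0; (m : ℂ) * z ^ (m - 1), 0])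
    (w₀ : ℂ) (hw₀ : w₀ ∈ coverOfPuncturedDisc r)
    (hΦSL : ∀ t ∈ Set.Ioo (-ε) ε, Φ t w₀ ∈ LoopSL ρ)
    (hmon : ∀ t ∈ Set.Ioo (-ε) ε, MonodromyProblem (monodromy (Φ t) w₀) l₁ l₂)
    (hdet : ∀ t ∈ Set.Ioo (-ε) ε, 0 ≤ (Complex.exp (-2 * θ * Complex.I) *
      ((a t).coeff 0 * (c t).coeff 0 - (b t).coeff 0 ^ 2)).re) :
    ∃ δ > 0, δ ≤ ε ∧ ∀ t ∈ Set.Ioo (-δ) δ,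
      (a t = 0 ∧ b t = 0 ∧ c t = 0) ∧
      ∃ H : ℂ → LoopMatrix ρ, LoopHolomorphicOn H (Metric.ball 0 r) ∧
        ∀ z ∈ puncturedDisc r, η t z = H z := by
  have hr : 0 < r := (norm_nonneg _).trans_lt (mem_coverOfPuncturedDisc.mp hw₀)
  have hm0 : m ≠ 0 := Nat.one_le_iff_ne_zero.mp hm
  obtain ⟨κ, hκ⟩ := eventually_isNearConj_residueMatrix (Ioo_mem_nhds (neg_lt_zero.mpr hε) hε) hm0
    hηC hη0 hpolar hΞ hΦ hΦC1 hw₀ hΦSL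
  obtain ⟨e, he, hvanish⟩ := exists_forall_eq_zero_of_monodromyProblem hl₁ hl₂ hsum hprod κ
  obtain ⟨δ, hδ, hnear⟩ := Metric.eventually_nhds_iff.mp (hκ e he)
  refine ⟨min δ ε, lt_min hδ hε, min_le_right _ _, fun t ht => ?_⟩
  have htδ : |t| < min δ ε := abs_lt.mpr ht
  have htε : t ∈ Set.Ioo (-ε) ε := abs_lt.mp (htδ.trans_le (min_le_right _ _))
  have hzero : a t = 0 ∧ b t = 0 ∧ c t = 0 :=
    hvanish (monodromy (Φ t) w₀) (a t) (b t) (c t) (differentiableOn_monodromy (hΦSL t htε))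
      (hmon t htε) (fun _ => (hpolar t htε).coeff_eq_zero hm0 hr (hΞ t htε) (hη t htε)) (hdet t htε)
      (hnear ((dist_zero_right t).trans_lt (htδ.trans_le (min_le_left _ _))))
  have hreg := hpolar t htε
  rw [hzero.1, hzero.2.1, hzero.2.2] at hreg
  exact ⟨hzero, Ξ t, hΞ t htε, fun _ => hreg.eq_of_eq_zero⟩

theorem mainTheorem7 (ρ : ℝ) [Fact (1 < ρ)]
    -- the Sym points
    (θ : ℝ) (l₁ l₂ : ℂ) (hl₁ : ‖l₁‖ < ρ) (hl₂ : ‖l₂‖ < ρ)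
    (hsum : ∃ s : ℝ, l₁ + l₂ = Complex.exp (θ * Complex.I) * s)
    (hprod : l₁ * l₂ = Complex.exp (2 * θ * Complex.I))
    -- the potentials `η t z dz` on the punctured disc and the solutions on its universal cover
    (m : ℕ) (hm : 1 ≤ m) (r ε : ℝ) (hr : 0 < r) (hε : 0 < ε)
    (η Φ : ℝ → ℂ → LoopMatrix ρ)
    (hη : ∀ t ∈ Set.Ioo (-ε) ε, IsDPWPotential (η t) (puncturedDisc r))
    (hΦSL : ∀ t ∈ Set.Ioo (-ε) ε, ∀ w ∈ coverOfPuncturedDisc r, Φ t w ∈ LoopSL ρ)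
    (hΦ : ∀ t ∈ Set.Ioo (-ε) ε, SolvesPotential (η t) (Φ t) r)
    (hηC1 : LoopC1On η (Set.Ioo (-ε) ε) (puncturedDisc r))
    (hΦC1 : LoopC1On Φ (Set.Ioo (-ε) ε) (coverOfPuncturedDisc r))
    -- the principal part
    (a b c : ℝ → Wiener ρ) (Ξ : ℝ → ℂ → LoopMatrix ρ)
    (hΞ : ∀ t ∈ Set.Ioo (-ε) ε, LoopHolomorphicOn (Ξ t) (Metric.ball 0 r))
    (hprincipal : ∀ t ∈ Set.Ioo (-ε) ε, ∀ z ∈ puncturedDisc r,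
      ∀ lam ∈ Metric.sphere (0 : ℂ) 1,
        (η t z).eval lam =
          ((a t).eval lam / z ^ (2 * m + 1) + (b t).eval lam / z ^ (m + 1) + (c t).eval lam / z) •
            !![0, lam⁻¹; 0, 0] + (Ξ t z).eval lam)
    -- the potential at `t = 0`
    (hη0 : ∀ z ∈ puncturedDisc r, ∀ lam ∈ Metric.sphere (0 : ℂ) 1,
      (η 0 z).eval lam = !![0, 0; (m : ℂ) * z ^ (m - 1), 0])
    -- the Monodromy Problem
    (w₀ : ℂ) (hw₀ : w₀ ∈ coverOfPuncturedDisc r)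
    (hmon : ∀ t ∈ Set.Ioo (-ε) ε, MonodromyProblem (monodromy (Φ t) w₀) l₁ l₂)
    -- the normalisations
    (ha0 : ∀ t ∈ Set.Ioo (-ε) ε, (a t).coeff 0 = 0)
    (hb0 : ∀ t ∈ Set.Ioo (-ε) ε, (Complex.exp (-θ * Complex.I) * (b t).coeff 0).re = 0) :
    ∃ δ > 0, δ ≤ ε ∧ ∀ t ∈ Set.Ioo (-δ) δ,
      (a t = 0 ∧ b t = 0 ∧ c t = 0) ∧
      ∃ H : ℂ → LoopMatrix ρ, LoopHolomorphicOn H (Metric.ball 0 r) ∧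
        ∀ z ∈ puncturedDisc r, η t z = H z := by
  refine mainTheorem7_general ρ θ l₁ l₂ hl₁ hl₂ hsum hprod m hm r ε hε η Φ
    (fun t ht => (hη t ht).coeff_eq_zero) (fun i j => (hηC1 i j).continuousOn) hΦ hΦC1 a b c Ξ hΞ
    hprincipal hη0 w₀ hw₀ (fun t ht => hΦSL t ht w₀ hw₀) hmon fun t ht => ?_
  rw [ha0 t ht, zero_mul, zero_sub]
  exact re_exp_mul_neg_sq_nonneg (hb0 t ht)
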